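/- Let $n$ be a natural number and $q$ a prime power such that either $n\ge 3$ and ($q\ge n+3$, or $q=n+2$ is prime), or $n=2$ and $q$ is odd. Let $H_\infty=\mathrm{PG}(n,q)$ be embedded as a hyperplane in $\mathrm{PG}(n+1,q)$, and let $\mathcal K$ be an arc of size $q$ in $H_\infty$, that is, a set of $q\ge n+1$ points of $H_\infty$ no $n+1$ of which lie in a hyperplane of $H_\infty$. Let $\Gamma_{n,q}(\mathcal K)$ be the bipartite point-line incidence graph whose vertices are the points of $\mathrm{PG}(n+1,q)\setminus H_\infty$ and the lines of $\mathrm{PG}(n+1,q)$ that contain a point of $\mathcal K$ and do not lie in $H_\infty$, a point and a line being adjacent when they are incident. Let $\mathrm{P\Gamma L}(n+2,q)_{\mathcal K}$ be the setwise stabiliser of $\mathcal K$ in the group $\mathrm{P\Gamma L}(n+2,q)$ of collineations of $\mathrm{PG}(n+1,q)$ induced by bijective semilinear maps. Then $$\mathrm{Aut}(\Gamma_{n,q}(\mathcal K))\cong \mathrm{P\Gamma L}(n+2,q)_{\mathcal K}.$$ More precisely, there is a group isomorphism $\mathrm{P\Gamma L}(n+2,q)_{\mathcal K}\to\mathrm{Aut}(\Gamma_{n,q}(\mathcal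 K))$ that sends every collineation $g$ to the graph automorphism that $g$ induces on the points and lines which are the vertices of $\Gamma_{n,q}(\mathcal K)$; in particular every automorphism of $\Gamma_{n,q}(\mathcal K)$ is induced by a collineation of $\mathrm{PG}(n+1,q)$. -/

import Mathlib

open scoped Pointwise LinearAlgebra.Projectivization

/-- The group `PΓL(V)`: the permutations of the points of the projective space `ℙ F V` that are
induced by a bijective map `φ` of `V` which is semilinear with respect to some automorphism `σ`
of the field `F`. -/
def PGammaL (F V : Type*) [Field F] [AddCommGroup V] [Module F V] :
    Subgroup (Equiv.Perm (ℙ F V)) where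
  carrier := {f | ∃ (σ : F ≃+* F) (φ : V ≃+ V), (∀ (c : F) (v : V), φ (c • v) = σ c • φ v) ∧
    ∀ (v : V) (hv : v ≠ 0),
      f (Projectivization.mk F v hv) = Projectivization.mk F (φ v) (φ.map_ne_zero_iff.2 hv)}
  one_mem' := ⟨RingEquiv.refl F, AddEquiv.refl V, fun _ _ => rfl, fun _ _ => rfl⟩
  mul_mem' := by
    rintro f g ⟨σ, φ, hφ, hf⟩ ⟨τ, ψ, hψ, hg⟩
    refine ⟨τ.trans σ, ψ.trans φ, fun c v => ?_, fun v hv => ?_⟩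
    · simp [hψ, hφ]
    · rw [Equiv.Perm.mul_apply, hg, hf]
      rfl
  inv_mem' := by
    rintro f ⟨σ, φ, hφ, hf⟩
    refine ⟨σ.symm, φ.symm, fun c v => ?_, fun v hv => ?_⟩
    · rw [AddEquiv.symm_apply_eq, hφ]
      simp
    · rw [Equiv.Perm.inv_eq_iff_eq, hf]
      simp

section LinearRepresentation

variable {F V : Type*} [Field F] [AddCommGroup V] [Module F V]

/-- The set of points of the projective subspace of `ℙ F V` given by the linear subspace `W`. -/
def pointsOf (W : Submodule F V) : Set (ℙ F V) := {P | P.submodule ≤ W}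

/-- `K` is a `k`-arc in the projective space `PG(H)` of projective dimension `finrank H - 1`:
a set of `k ≥ finrank H` points of `PG(H)`, no `finrank H` of which lie in a hyperplane of
`PG(H)`. -/
structure IsArc (H : Submodule F V) (k : ℕ) (K : Set (ℙ F V)) : Prop where
  subset : K ⊆ pointsOf H
  encard_eq : K.encard = k
  le_card : Module.finrank F H ≤ k
  not_subset_hyperplane : ∀ W : Submodule F V, W ≤ H →
    Module.finrank F W + 1 = Module.finrank F H →
    ∀ S : Finset (ℙ F V), (S : Set (ℙ F V)) ⊆ K → S.card = Module.finrank F H →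
      ¬ (S : Set (ℙ F V)) ⊆ pointsOf W

/-- The affine points: the points of `ℙ F V` outside the hyperplane at infinity `H`. -/
def AffinePoint (H : Submodule F V) : Type _ := {P : ℙ F V // P ∉ pointsOf H}

/-- The lines of `ℙ F V` that contain a point of `K` and do not lie in `H`. -/
def RepLine (H : Submodule F V) (K : Set (ℙ F V)) : Type _ :=
  {L : Submodule F V // Module.finrank F L = 2 ∧ (∃ P ∈ K, P ∈ pointsOf L) ∧ ¬ L ≤ H}

/-- The point-line incidence graph of the linear representation of `K`, where `K` is a set of
points of the hyperplane at infinity `H`. -/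
def linRepGraph (H : Submodule F V) (K : Set (ℙ F V)) :
    SimpleGraph (AffinePoint H ⊕ RepLine H K) where
  Adj
    | .inl P, .inr L => P.1 ∈ pointsOf L.1
    | .inr L, .inl P => P.1 ∈ pointsOf L.1
    | _, _ => False
  symm := ⟨by rintro (P | L) (Q | M) h <;> exact h⟩
  loopless := ⟨by rintro (P | L) h <;> exact h⟩

/-- The automorphism `α` of the incidence graph is induced by the permutation `g` of the points
of `ℙ F V`: it maps every affine point `P` to `g P`, and every line `L` to the line whose set of
points is the image under `g` of the set of points of `L`. -/
def IsInducedBy {H : Submodule F V} {K : Set (ℙ F V)}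
    (α : linRepGraph H K ≃g linRepGraph H K) (g : Equiv.Perm (ℙ F V)) : Prop :=
  (∀ P : AffinePoint H, ∃ P' : AffinePoint H, α (.inl P) = .inl P' ∧ P'.1 = g P.1) ∧
  (∀ L : RepLine H K, ∃ L' : RepLine H K,
    α (.inr L) = .inr L' ∧ pointsOf L'.1 = g '' pointsOf L.1)

end LinearRepresentation

/-! A collineation stabilising `K` also stabilises `H`, since `K` spans `H`, so it acts on the
graph; it is determined by its action on the points outside `H`. The substance is that every graph
automorphism arises in this way.

Choosing an origin off `H` turns the graph into the incidence graph of the vector space `H` and its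
lines in the `q` arc directions (`exists_affGraph_iso`). There the arc condition says that any `n +
1` directions are independent. The argument then has three steps.

Points and lines are not interchanged (`isLeft_apply_zero`). A swap would yield a vector, not a
multiple of any direction, such that every arc direction lies with another one in a plane containing
it. Four independent directions exclude this when `n ≥ 3`; when `n = 2` these planes would pair off
an odd number of directions.

Parallel lines go to parallel lines (`exists_apply_eq_lineThrough`). Otherwise two parallel lines
have images in different directions, and the `q` transversals joining corresponding points of the
images need `q` distinct directions, while one of the `q` available directions is excluded.

The resulting map of `H` is semilinear up to translation (`exists_semilinear`). In a frame made of
`n + 2` directions it acts on every coordinate by one additive map `φ`. The scalars that `φ` turns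
into scalars form an additive subgroup containing all coordinate ratios of the remaining directions.
For `q ≥ n + 3` these ratios make it larger than half of `F`; for `q` prime it is everything because
it contains 1. So `φ` is a multiple of a field automorphism. For `q = n + 1 = 3` there is no frame,
but an injection of the field with three elements fixing 0 is already linear. -/

/-! ### Maps that act coordinatewise, and their multipliers -/

section CoordinateMaps

variable {F W κ : Type*} [Field F] [AddCommGroup W] [Module F W]

/-- If `f` maps lines in the direction of `B i` into lines in the direction of `B' i`, then the
`i`-th coordinate of `f x` only depends on the `i`-th coordinate of `x`. -/
lemma repr_apply_eq_of_repr_eq [Fintype κ] (B B' : Module.Basis κ F W) {f : W → W}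
    (hf : ∀ x (t : F) i, ∃ s : F, f (x + t • B i) = f x + s • B' i) {i : κ} {x y : W}
    (h : B.repr x i = B.repr y i) : B'.repr (f x) i = B'.repr (f y) i := by
  classical
  -- Walk from `x` to `y` one coordinate at a time: only steps along `B a` with `a ≠ i` move the
  -- point, and their images leave the `i`-th coordinate unchanged.
  have key : ∀ S : Finset κ,
      B'.repr (f (x + ∑ j ∈ S, (B.repr y j - B.repr x j) • B j)) i = B'.repr (f x) i := by
    intro S
    induction S using Finset.induction_on with
    | empty => simp
    | insert a S ha ih =>
      rw [Finset.sum_insert ha, add_comm (_ • B a), ← add_assoc]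
      rcases eq_or_ne a i with rfl | hai
      · rw [h, sub_self, zero_smul, add_zero, ih]
      · obtain ⟨s, hs⟩ := hf (x + ∑ j ∈ S, (B.repr y j - B.repr x j) • B j)
          (B.repr y a - B.repr x a) a
        rw [hs]
        simp [ih, hai]
  have hy : x + ∑ j, (B.repr y j - B.repr x j) • B j = y := by
    simp_rw [sub_smul, Finset.sum_sub_distrib, B.sum_repr]
    abel
  rw [← key Finset.univ, hy]

/-- If moreover `f` maps lines in the direction of `∑ i, B i` into lines in the direction of
`∑ i, B' i`, then `f` acts on all coordinates by the same additive map. -/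
lemma exists_addMonoidHom_repr_apply [Fintype κ] [Nontrivial κ] (B B' : Module.Basis κ F W)
    {f : W → W}
    (h0 : f 0 = 0) (hf : ∀ x (t : F) i, ∃ s : F, f (x + t • B i) = f x + s • B' i)
    (hu : ∀ x (t : F), ∃ s : F, f (x + t • ∑ i, B i) = f x + s • ∑ i, B' i) :
    ∃ φ : F →+ F, ∀ x i, B'.repr (f x) i = φ (B.repr x i) := by
  classical
  set g : κ → F → F := fun i t => B'.repr (f (t • B i)) i with hg
  have hgf : ∀ x i, B'.repr (f x) i = g i (B.repr x i) := fun x i =>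
    repr_apply_eq_of_repr_eq B B' hf (by simp)
  have hg0 : ∀ i, g i 0 = 0 := fun i => by simp [hg, h0]
  have hsum : ∀ (C : Module.Basis κ F W) i, C.repr (∑ j, C j) i = 1 := fun C i => by
    simp [Finsupp.single_apply]
  -- A step along the all-ones direction changes all image coordinates by the same amount. As `u`
  -- and `v` are independent, this increment depends on `t` alone, which gives additivity and
  -- equality of the coordinate maps together.
  have key : ∀ i j, i ≠ j → ∀ u v t, g i (u + t) - g i u = g j (v + t) - g j v := by
    intro i j hij u v t
    obtain ⟨s, hs⟩ := hu (u • B i + v • B j) t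
    have h : ∀ k, g k (B.repr (u • B i + v • B j) k + t)
        = g k (B.repr (u • B i + v • B j) k) + s := by
      intro k
      have := congrArg (fun z => B'.repr z k) hs
      simp only [map_add, Finsupp.add_apply, hgf, map_smul, Finsupp.smul_apply, hsum,
        smul_eq_mul, mul_one] at this ⊢
      exact this
    have hi := h i
    have hj := h j
    simp [hij, hij.symm] at hi hj
    rw [hi, hj]
    ring
  obtain ⟨i₀, j₀, hij⟩ := exists_pair_ne κ
  have hadd : ∀ u t, g i₀ (u + t) = g i₀ u + g i₀ t := by
    intro u t
    have h1 := key i₀ j₀ hij u 0 t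
    have h2 := key i₀ j₀ hij 0 0 t
    simp only [zero_add, hg0, sub_zero] at h1 h2
    rw [← h2] at h1
    linear_combination h1
  refine ⟨⟨⟨g i₀, hg0 i₀⟩, hadd⟩, fun x i => ?_⟩
  rw [hgf]
  change _ = g i₀ _
  rcases eq_or_ne i i₀ with rfl | hi
  · rfl
  · simpa [hg0] using key i i₀ hi 0 0 (B.repr x i)

/-- A map acting on coordinates by multiples of a field automorphism is semilinear. -/
lemma semilinear_of_repr_apply (B B' : Module.Basis κ F W) {f : W → W} (σ : F →+* F) (c : κ → F)
    (h : ∀ x i, B'.repr (f x) i = c i * σ (B.repr x i)) :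
    (∀ x y, f (x + y) = f x + f y) ∧ ∀ (a : F) x, f (a • x) = σ a • f x := by
  refine ⟨fun x y => B'.repr.injective (Finsupp.ext fun i => ?_),
    fun a x => B'.repr.injective (Finsupp.ext fun i => ?_)⟩
  · simp [h, mul_add]
  · simp [h, mul_left_comm]

/-- The elements `c` such that `φ (t * c)` is a constant multiple of `φ t`. -/
def multiplierSubgroup (φ : F →+ F) : AddSubgroup F where
  carrier := {c | ∃ c', ∀ t, φ (t * c) = c' * φ t}
  zero_mem' := ⟨0, by simp⟩
  add_mem' := by
    rintro a b ⟨a', ha⟩ ⟨b', hb⟩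
    exact ⟨a' + b', fun t => by rw [mul_add, map_add, ha, hb, add_mul]⟩
  neg_mem' := by
    rintro a ⟨a', ha⟩
    exact ⟨-a', fun t => by rw [mul_neg, map_neg, ha, neg_mul]⟩

/-- Evaluating the multiplier identity at `t = 1` forces `c' = φ c / φ 1`, so `φ / φ 1` is
multiplicative. -/
lemma exists_ringHom_of_multiplierSubgroup_eq_top {φ : F →+ F} (hφ : φ 1 ≠ 0)
    (h : multiplierSubgroup φ = ⊤) : ∃ σ : F →+* F, ∀ t, φ t = φ 1 * σ t := by
  have key : ∀ t c, φ (t * c) * φ 1 = φ t * φ c := by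
    intro t c
    obtain ⟨c', hc⟩ : c ∈ multiplierSubgroup φ := h ▸ AddSubgroup.mem_top c
    have h1 := hc 1
    rw [one_mul] at h1
    rw [hc, h1]
    ring
  refine ⟨{ toFun := fun t => φ t / φ 1
            map_one' := div_self hφ
            map_mul' := fun a b => ?_
            map_zero' := by simp
            map_add' := fun a b => by rw [map_add, add_div] }, fun t => ?_⟩
  · field_simp
    exact key a b
  · change φ t = φ 1 * (φ t / φ 1)
    field_simp

end CoordinateMaps

/-! ### Arcs as families of vectors: coordinates and frames -/

section ArcFamily

variable {F W ι κ : Type*} [Field F] [AddCommGroup W] [Module F W] {d : ι → W} {r : ℕ}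

/-- A family of vectors such that any `r` of them are linearly independent (and any smaller number
of them as well). -/
def IsArcFamily (F : Type*) {W ι : Type*} [Field F] [AddCommGroup W] [Module F W] (r : ℕ)
    (d : ι → W) : Prop :=
  ∀ (S : Finset ι) (m : ι), m ∉ S → S.card < r → d m ∉ Submodule.span F (d '' (S : Set ι))

namespace IsArcFamily

lemma linearIndependent_comp [Fintype κ] (hd : IsArcFamily F r d) {b : κ → ι}
    (hb : Function.Injective b) (hr : Fintype.card κ ≤ r) : LinearIndependent F (d ∘ b) := by
  classical
  rw [linearIndependent_iff_notMem_span]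
  intro i hi
  refine hd ((Finset.univ.erase i).image b) (b i) ?_ ?_ ?_
  · simp [hb.eq_iff]
  · refine Finset.card_image_le.trans_lt (lt_of_lt_of_le ?_ hr)
    exact Finset.card_erase_lt_of_mem (Finset.mem_univ i)
  · have h : d '' (((Finset.univ.erase i).image b : Finset ι) : Set ι)
        = (d ∘ b) '' (Set.univ \ {i}) := by
      rw [Finset.coe_image, ← Set.image_comp]
      congr 1
      ext
      simp
    rw [h]
    exact hi

lemma mem_span_image_of_repr_eq_zero [Fintype κ] [DecidableEq ι] {b : κ → ι}
    (B : Module.Basis κ F W)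
    (hB : ∀ i, ∃ a : F, a ≠ 0 ∧ B i = a • d (b i)) (T : Finset κ) {x : W}
    (hx : ∀ i ∉ T, B.repr x i = 0) :
    x ∈ Submodule.span F (d '' (T.image b : Set ι)) := by
  rw [← B.sum_repr x]
  refine Submodule.sum_mem _ fun i _ => ?_
  by_cases hi : i ∈ T
  · obtain ⟨a, -, ha⟩ := hB i
    rw [ha]
    refine Submodule.smul_mem _ _ (Submodule.smul_mem _ _ (Submodule.subset_span ⟨b i, ?_, rfl⟩))
    simpa using ⟨i, hi, rfl⟩
  · rw [hx i hi, zero_smul]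
    exact Submodule.zero_mem _

variable [Fintype κ] {b : κ → ι} {B : Module.Basis κ F W}

/-- A vanishing coordinate would put `d m` in the span of only `card κ - 1` other members. -/
lemma repr_ne_zero (hd : IsArcFamily F (Fintype.card κ) d)
    (hB : ∀ i, ∃ a : F, a ≠ 0 ∧ B i = a • d (b i)) {m : ι} (hm : m ∉ Set.range b) (i : κ) :
    B.repr (d m) i ≠ 0 := by
  classical
  intro h
  refine hd ((Finset.univ.erase i).image b) m ?_ ?_
    (mem_span_image_of_repr_eq_zero B hB _ (by simpa using h))
  · intro hmem
    obtain ⟨k, -, rfl⟩ := Finset.mem_image.1 hmem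
    exact hm ⟨k, rfl⟩
  · exact Finset.card_image_le.trans_lt (Finset.card_erase_lt_of_mem (Finset.mem_univ i))

/-- Equality would make a combination of `d m` and `d m'` vanish in both coordinates `i` and `j`, so
`d m` would lie in the span of `d m'` and `card κ - 2` basis directions. This is what makes
coordinate ratios of different members distinct. -/
lemma repr_mul_repr_ne (hd : IsArcFamily F (Fintype.card κ) d)
    (hB : ∀ i, ∃ a : F, a ≠ 0 ∧ B i = a • d (b i)) {m m' : ι} (hm : m ∉ Set.range b)
    (hm' : m' ∉ Set.range b) (hne : m ≠ m') {i j : κ} (hij : i ≠ j) :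
    B.repr (d m) i * B.repr (d m') j ≠ B.repr (d m) j * B.repr (d m') i := by
  classical
  intro h
  set T : Finset κ := (Finset.univ.erase i).erase j with hT
  have hz := mem_span_image_of_repr_eq_zero B hB T
    (x := B.repr (d m') j • d m - B.repr (d m) j • d m') (by
      intro k hk
      have : k = j ∨ k = i := by
        by_contra hcon
        simp only [not_or] at hcon
        exact hk (by simp [hT, hcon])
      rcases this with rfl | rfl
      · simp [mul_comm]
      · simp only [map_sub, map_smul, Finsupp.sub_apply, Finsupp.smul_apply, smul_eq_mul]
        linear_combination h)
  refine hd (insert m' (T.image b)) m ?_ ?_ ?_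
  · simp only [Finset.mem_insert, Finset.mem_image, not_or]
    exact ⟨hne, fun ⟨k, _, hk⟩ => hm ⟨k, hk⟩⟩
  · have h1 : T.card + 1 = (Finset.univ.erase i).card :=
      Finset.card_erase_add_one (by simpa using hij.symm)
    have h2 : (Finset.univ.erase i).card + 1 = Fintype.card κ :=
      Finset.card_erase_add_one (Finset.mem_univ i)
    have h3 := Finset.card_insert_le m' (T.image b)
    have h4 : (T.image b).card ≤ T.card := Finset.card_image_le
    omega
  · have hj := repr_ne_zero hd hB hm' j
    have h1 : d m = (B.repr (d m') j)⁻¹ • ((B.repr (d m') j • d m - B.repr (d m) j • d m')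
        + B.repr (d m) j • d m') := by
      rw [sub_add_cancel, inv_smul_smul₀ hj]
    rw [h1]
    refine Submodule.smul_mem _ _ (Submodule.add_mem _ ?_ (Submodule.smul_mem _ _ ?_))
    · exact Submodule.span_mono (Set.image_mono (by simp)) hz
    · exact Submodule.subset_span ⟨m', by simp, rfl⟩

/-- A frame: a basis consisting of multiples of members of the family, the sum of which is another
member of the family. -/
lemma exists_basis_sum_eq (hd : IsArcFamily F (Fintype.card κ) d)
    (hW : Module.finrank F W = Fintype.card κ) [Nonempty κ] {b : κ → ι}
    (hb : Function.Injective b) {l : ι} (hl : l ∉ Set.range b) :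
    ∃ B : Module.Basis κ F W, (∀ i, ∃ a : F, a ≠ 0 ∧ B i = a • d (b i)) ∧ ∑ i, B i = d l := by
  set B₀ := basisOfLinearIndependentOfCardEqFinrank (hd.linearIndependent_comp hb le_rfl) hW.symm
  have hB₀ : ∀ i, B₀ i = d (b i) := fun i => by simp [B₀]
  have hc : ∀ i, B₀.repr (d l) i ≠ 0 :=
    repr_ne_zero hd (fun i => ⟨1, one_ne_zero, by rw [hB₀, one_smul]⟩) hl
  refine ⟨B₀.unitsSMul fun i => Units.mk0 _ (hc i), fun i => ⟨_, hc i, ?_⟩, ?_⟩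
  · rw [Module.Basis.unitsSMul_apply, hB₀]
    rfl
  · simp_rw [Module.Basis.unitsSMul_apply]
    exact B₀.sum_repr (d l)

end IsArcFamily

lemma AddSubgroup.eq_top_of_card_lt_two_mul {A : Type*} [AddGroup A] [Finite A] (E : AddSubgroup A)
    (h : Nat.card A < 2 * Nat.card E) : E = ⊤ := by
  rw [← AddSubgroup.index_eq_one]
  have h1 := E.card_mul_index
  have h2 : E.index ≠ 0 := AddSubgroup.index_ne_zero_of_finite
  by_contra h3
  have h4 : 2 ≤ E.index := by omega
  have := Nat.mul_le_mul_left (Nat.card E) h4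
  omega

/-! ### Semilinearity of maps preserving the arc directions -/

namespace IsArcFamily

variable {n : ℕ} {f : W → W} {π : ι → ι}

/-- The multiplier subgroup contains all ratios of coordinates of members of the family. -/
lemma div_mem_multiplierSubgroup [Fintype κ] {b : κ → ι} {B B' : Module.Basis κ F W}
    (hd : IsArcFamily F (Fintype.card κ) d)
    (hB' : ∀ i, ∃ a : F, a ≠ 0 ∧ B' i = a • d (π (b i))) (hπ : Function.Injective π)
    (h0 : f 0 = 0) (hf : ∀ x (t : F) i, ∃ s : F, f (x + t • d i) = f x + s • d (π i))
    {φ : F →+ F} (hφ : ∀ x i, B'.repr (f x) i = φ (B.repr x i)) {m : ι} (hm : m ∉ Set.range b)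
    (i j : κ) (hj : B.repr (d m) j ≠ 0) :
    B.repr (d m) i / B.repr (d m) j ∈ multiplierSubgroup φ := by
  have hj' : B'.repr (d (π m)) j ≠ 0 := by
    refine repr_ne_zero hd (b := π ∘ b) hB' ?_ j
    rintro ⟨k, hk⟩
    exact hm ⟨k, hπ hk⟩
  refine ⟨B'.repr (d (π m)) i / B'.repr (d (π m)) j, fun t => ?_⟩
  -- The parameter is scaled so that the `j`-th coordinate of the point on the line of `d m` is `t`.
  obtain ⟨s, hs⟩ := hf 0 (t / B.repr (d m) j) m
  rw [h0, zero_add, zero_add] at hs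
  have key : ∀ k, φ (t / B.repr (d m) j * B.repr (d m) k) = s * B'.repr (d (π m)) k := by
    intro k
    have h1 := hφ ((t / B.repr (d m) j) • d m) k
    rw [hs] at h1
    simpa using h1.symm
  have h1 := key i
  have h2 := key j
  rw [div_mul_cancel₀ _ hj] at h2
  have h3 : t * (B.repr (d m) i / B.repr (d m) j) = t / B.repr (d m) j * B.repr (d m) i := by
    ring
  rw [h3, h1, h2]
  field_simp

/-- Two families of ratios bound the order of the subgroup from below by `q - card κ + 1` and `card
κ + 1`. These add up to `q + 2`, so the order exceeds `q / 2`. -/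
lemma multiplierSubgroup_eq_top [Finite F] [Finite ι] [Fintype κ] {b : κ → ι}
    {B B' : Module.Basis κ F W} (hd : IsArcFamily F (Fintype.card κ) d)
    (hb : Function.Injective b) (hκ : 2 ≤ Fintype.card κ) (hι : Nat.card ι = Nat.card F)
    (hq : Fintype.card κ + 2 ≤ Nat.card F ∨ (Nat.card F).Prime)
    (hB : ∀ i, ∃ a : F, a ≠ 0 ∧ B i = a • d (b i))
    {l : ι} (hl : l ∉ Set.range b) (hsum : ∑ i, B i = d l)
    (hB' : ∀ i, ∃ a : F, a ≠ 0 ∧ B' i = a • d (π (b i))) (hπ : Function.Injective π)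
    (h0 : f 0 = 0) (hf : ∀ x (t : F) i, ∃ s : F, f (x + t • d i) = f x + s • d (π i))
    {φ : F →+ F} (hφ : ∀ x i, B'.repr (f x) i = φ (B.repr x i)) :
    multiplierSubgroup φ = ⊤ := by
  classical
  have : Nontrivial κ := Fintype.one_lt_card_iff_nontrivial.1 hκ
  obtain ⟨i₀, j₀, hij⟩ := exists_pair_ne κ
  rcases hq with hq | hq
  · have hne : ∀ {m}, m ∉ Set.range b → ∀ i, B.repr (d m) i ≠ 0 := fun hm => repr_ne_zero hd hB hm
    have hcl : ∀ i, B.repr (d l) i = 1 := fun i => by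
      rw [← hsum]
      simp [Finsupp.single_apply]
    have hmem : ∀ {m}, m ∉ Set.range b → ∀ i j,
        B.repr (d m) i / B.repr (d m) j ∈ multiplierSubgroup φ := fun hm i j =>
      div_mem_multiplierSubgroup hd hB' hπ h0 hf hφ hm i j (hne hm j)
    have hcompl : Nat.card {m // m ∉ Set.range b} + Fintype.card κ = Nat.card ι := by
      have h1 : Nat.card (Set.range b) = Fintype.card κ := by
        rw [Nat.card_range_of_injective hb, Nat.card_eq_fintype_card]
      have h2 := Set.ncard_add_ncard_compl (Set.range b)
      rw [← Nat.card_coe_set_eq, ← Nat.card_coe_set_eq, h1, add_comm] at h2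
      exact h2
    -- Fixed pair of coordinates, varying member; the value `none` of the option contributes 0,
    -- which is no ratio.
    have h1 : Nat.card {m // m ∉ Set.range b} + 1 ≤ Nat.card (multiplierSubgroup φ) := by
      rw [← Finite.card_option]
      refine Nat.card_le_card_of_injective (fun o => o.elim 0 fun m =>
        ⟨_, hmem m.2 i₀ j₀⟩) ?_
      rintro (_ | m) (_ | m') h
      · rfl
      · exact absurd (congrArg Subtype.val h).symm (div_ne_zero (hne m'.2 _) (hne m'.2 _))
      · exact absurd (congrArg Subtype.val h) (div_ne_zero (hne m.2 _) (hne m.2 _))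
      · by_contra hcon
        refine repr_mul_repr_ne hd hB m.2 m'.2 (fun h => hcon (by rw [Subtype.ext h])) hij ?_
        have h := congrArg Subtype.val h
        simp only [Option.elim_some] at h
        rw [div_eq_div_iff (hne m.2 _) (hne m'.2 _)] at h
        rw [h, mul_comm]
    -- A member outside the frame exists because `q ≥ card κ + 2`. Compared with the all-ones vector
    -- `d l`, its coordinates are pairwise distinct.
    obtain ⟨m, hml⟩ : ∃ m : {m // m ∉ Set.range b}, m ≠ ⟨l, hl⟩ := by
      have : Nontrivial {m // m ∉ Set.range b} := by
        rw [← Finite.one_lt_card_iff_nontrivial]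
        omega
      exact exists_ne _
    have h2 : Fintype.card κ + 1 ≤ Nat.card (multiplierSubgroup φ) := by
      rw [← Nat.card_eq_fintype_card, ← Finite.card_option]
      refine Nat.card_le_card_of_injective (fun o => o.elim 0 fun i =>
        ⟨_, hmem m.2 i i₀⟩) ?_
      rintro (_ | i) (_ | j) h
      · rfl
      · exact absurd (congrArg Subtype.val h).symm (div_ne_zero (hne m.2 _) (hne m.2 _))
      · exact absurd (congrArg Subtype.val h) (div_ne_zero (hne m.2 _) (hne m.2 _))
      · by_contra hcon
        refine repr_mul_repr_ne hd hB m.2 hl (fun h => hml (Subtype.ext h))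
          (i := i) (j := j) (fun h => hcon (by rw [h])) ?_
        have h := congrArg Subtype.val h
        simp only [Option.elim_some] at h
        rw [div_left_inj' (hne m.2 _)] at h
        rw [h, hcl, hcl]
    exact AddSubgroup.eq_top_of_card_lt_two_mul _ (by omega)
  · have : Fact (Nat.card F).Prime := ⟨hq⟩
    refine ((multiplierSubgroup φ).eq_bot_or_eq_top_of_prime_card).resolve_left fun h => ?_
    have h1 : (1 : F) ∈ multiplierSubgroup φ := ⟨1, by simp⟩
    rw [h, AddSubgroup.mem_bot] at h1
    exact one_ne_zero h1

/-- An injective map preserving the lines with directions in an arc is semilinear, if it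
fixes `0`. -/
theorem exists_semilinear [Finite F] [Finite ι] (hd : IsArcFamily F (n + 1) d) (hn : 1 ≤ n)
    (hW : Module.finrank F W = n + 1) (hι : Nat.card ι = Nat.card F)
    (hq : n + 3 ≤ Nat.card F ∨ (Nat.card F = n + 2 ∧ (Nat.card F).Prime) ∨
      (Nat.card F = n + 1 ∧ Nat.card F = 3))
    (hfi : Function.Injective f) (hπ : Function.Injective π)
    (h0 : f 0 = 0) (hf : ∀ x (t : F) i, ∃ s : F, f (x + t • d i) = f x + s • d (π i)) :
    ∃ σ : F ≃+* F, (∀ x y, f (x + y) = f x + f y) ∧ ∀ (a : F) x, f (a • x) = σ a • f x := by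
  classical
  have hcard : Fintype.card (Fin (n + 1)) = n + 1 := Fintype.card_fin _
  obtain ⟨b⟩ : Nonempty (Fin (n + 1) ↪ ι) := by
    have := Fintype.ofFinite ι
    refine Function.Embedding.nonempty_of_card_le ?_
    rw [hcard, ← Nat.card_eq_fintype_card, hι]
    omega
  have hd' := hd
  rw [← hcard] at hd' hW
  have hbasis : ∀ {B B' : Module.Basis (Fin (n + 1)) F W},
      (∀ i, ∃ a : F, a ≠ 0 ∧ B i = a • d (b i)) →
      (∀ i, ∃ a : F, a ≠ 0 ∧ B' i = a • d (π (b i))) →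
      ∀ x (t : F) i, ∃ s : F, f (x + t • B i) = f x + s • B' i := by
    intro B B' hB hB' x t i
    obtain ⟨a, -, ha⟩ := hB i
    obtain ⟨a', ha0, ha'⟩ := hB' i
    obtain ⟨s, hs⟩ := hf x (t * a) (b i)
    refine ⟨s / a', ?_⟩
    rw [ha, ha', smul_smul, hs, smul_smul, div_mul_cancel₀ _ ha0]
  -- Here the arc is only a basis, with no further member to serve as the sum direction; the
  -- coordinate maps need not agree, but each is linear.
  by_cases hq3 : Nat.card F = n + 1 ∧ Nat.card F = 3
  · have hF : ∀ g : F → F, Function.Injective g → g 0 = 0 → ∀ t, g t = g 1 * t := by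
      intro g hg hg0 t
      have : Fintype F := Fintype.ofFinite F
      have hF3 : Fintype.card F = 3 := by rw [← Nat.card_eq_fintype_card]; exact hq3.2
      have hset : ∀ u : F, u ≠ 0 → ∀ t : F, t = 0 ∨ t = u ∨ t = -u := by
        intro u hu t
        have hne : u ≠ -u := by
          intro h
          have h2 : (2 : F) = 0 := by
            have : (2 : F) * u = 0 := by linear_combination h
            exact (mul_eq_zero.1 this).resolve_right hu
          have h3 : (3 : F) = 0 := by
            have := Nat.cast_card_eq_zero F
            rw [hF3] at this
            exact_mod_cast this
          exact one_ne_zero (α := F) (by linear_combination h3 - h2)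
        have hc : ({0, u, -u} : Finset F) = Finset.univ := by
          rw [← Finset.card_eq_iff_eq_univ, hF3]
          rw [Finset.card_insert_of_notMem, Finset.card_pair hne]
          simpa using ⟨hu.symm, hu⟩
        have := Finset.mem_univ t
        rw [← hc] at this
        simpa using this
      have hg1 : g 1 ≠ 0 := fun h => one_ne_zero (hg (h.trans hg0.symm))
      rcases hset 1 one_ne_zero t with rfl | rfl | rfl
      · rw [hg0, mul_zero]
      · rw [mul_one]
      · rcases hset (g 1) hg1 (g (-1)) with h | h | h
        · exact absurd (hg (h.trans hg0.symm)) (by simp)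
        · have := hg h
          rcases hset 1 one_ne_zero (g 1) with h' | h' | h'
          · exact absurd h' hg1
          · rw [this, h', mul_one]
          · rw [this, mul_one]
        · rw [h, mul_neg_one]
    have hπb : Function.Injective (π ∘ b) := hπ.comp b.injective
    set B := basisOfLinearIndependentOfCardEqFinrank
      (hd'.linearIndependent_comp b.injective le_rfl) hW.symm
    set B' := basisOfLinearIndependentOfCardEqFinrank
      (hd'.linearIndependent_comp hπb le_rfl) hW.symm
    have hB : ∀ i, ∃ a : F, a ≠ 0 ∧ B i = a • d (b i) := fun i => ⟨1, one_ne_zero, by simp [B]⟩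
    have hB' : ∀ i, ∃ a : F, a ≠ 0 ∧ B' i = a • d (π (b i)) :=
      fun i => ⟨1, one_ne_zero, by simp [B']⟩
    have hline := hbasis hB hB'
    have hlin : ∀ x i, B'.repr (f x) i = B'.repr (f (B i)) i * RingHom.id F (B.repr x i) := by
      intro x i
      have hinj : Function.Injective fun t : F => B'.repr (f (t • B i)) i := by
        intro t t' ht
        obtain ⟨s, hs⟩ := hline 0 t i
        obtain ⟨s', hs'⟩ := hline 0 t' i
        rw [h0, zero_add, zero_add] at hs hs'
        simp only [hs, hs'] at ht
        have hss : s = s' := by simpa using ht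
        have := hfi (hs.trans ((hss ▸ rfl : s • B' i = s' • B' i).trans hs'.symm))
        simpa using congrArg (fun z => B.repr z i) this
      have h1 := hF _ hinj (by simp [h0]) (B.repr x i)
      simp only [one_smul] at h1
      rw [RingHom.id_apply, ← h1]
      exact repr_apply_eq_of_repr_eq B B' hline (by simp)
    exact ⟨RingEquiv.refl F, semilinear_of_repr_apply B B' (RingHom.id F) _ hlin⟩
  · replace hq : n + 3 ≤ Nat.card F ∨ (Nat.card F = n + 2 ∧ (Nat.card F).Prime) := by tauto
    obtain ⟨l, hl⟩ : ∃ l, l ∉ Set.range b := by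
      by_contra! hcon
      have h1 := Nat.card_le_card_of_surjective b hcon
      rw [Nat.card_fin, hι] at h1
      omega
    have : Nontrivial (Fin (n + 1)) := Fin.nontrivial_iff_two_le.2 (by omega)
    obtain ⟨B, hB, hBl⟩ := exists_basis_sum_eq hd' hW b.injective hl
    obtain ⟨B', hB', hBl'⟩ := exists_basis_sum_eq hd' hW (hπ.comp b.injective)
      (l := π l) (by rintro ⟨k, hk⟩; exact hl ⟨k, hπ hk⟩)
    obtain ⟨φ, hφ⟩ := exists_addMonoidHom_repr_apply B B' h0 (hbasis hB hB')
      (by rw [hBl, hBl']; exact fun x t => hf x t l)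
    have htop := multiplierSubgroup_eq_top hd' b.injective (by omega) hι
      (by rw [hcard]; tauto) hB hl hBl hB' hπ h0 hf hφ
    have hφ1 : φ 1 ≠ 0 := by
      intro h
      have h1 : f (B 0) = 0 := by
        refine B'.repr.injective (Finsupp.ext fun i => ?_)
        rw [hφ, B.repr_self, Finsupp.single_apply]
        split_ifs <;> simp [h]
      exact B.ne_zero 0 (hfi (h1.trans h0.symm))
    obtain ⟨σ, hσ⟩ := exists_ringHom_of_multiplierSubgroup_eq_top hφ1 htop
    refine ⟨RingEquiv.ofBijective σ (Finite.injective_iff_bijective.1 σ.injective), ?_⟩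
    exact semilinear_of_repr_apply B B' σ (fun _ => φ 1) fun x i => by rw [hφ, hσ]

end IsArcFamily

end ArcFamily

/-! ### Short linear relations between arc directions -/

section AffineModel

variable {F W ι : Type*} [Field F] [AddCommGroup W] [Module F W] {d : ι → W} {r : ℕ}

namespace IsArcFamily

lemma mono (hd : IsArcFamily F r d) {r' : ℕ} (h : r' ≤ r) : IsArcFamily F r' d :=
  fun S m hm hS => hd S m hm (hS.trans_le h)

lemma eq_zero_of_smul_mem_span (hd : IsArcFamily F r d) {S : Finset ι} {m : ι} (hm : m ∉ S)
    (hS : S.card < r) {a : F} (ha : a • d m ∈ Submodule.span F (d '' (S : Set ι))) : a = 0 := by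
  by_contra h
  exact hd S m hm hS ((Submodule.smul_mem_iff _ h).1 ha)

/-- The other indices may coincide, so degenerate relations need no separate treatment; the same
holds for four terms. -/
lemma coeff_eq_zero_of_three (hd : IsArcFamily F 3 d) {i j k : ι} (hij : i ≠ j) (hik : i ≠ k)
    {a b c : F} (h : a • d i + b • d j + c • d k = 0) : a = 0 := by
  classical
  refine hd.eq_zero_of_smul_mem_span (m := i) (S := {j, k}) (by simp [hij, hik])
    (Finset.card_le_two.trans_lt (by norm_num)) ?_
  have h1 : a • d i = (-b) • d j + (-c) • d k := by
    rw [neg_smul, neg_smul, ← sub_eq_zero, ← h]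
    abel
  rw [h1]
  exact Submodule.add_mem _
    (Submodule.smul_mem _ _ (Submodule.subset_span ⟨j, by simp, rfl⟩))
    (Submodule.smul_mem _ _ (Submodule.subset_span ⟨k, by simp, rfl⟩))

lemma coeff_eq_zero_of_four (hd : IsArcFamily F 4 d) {i j k l : ι} (hij : i ≠ j) (hik : i ≠ k)
    (hil : i ≠ l) {a b c e : F} (h : a • d i + b • d j + c • d k + e • d l = 0) : a = 0 := by
  classical
  refine hd.eq_zero_of_smul_mem_span (m := i) (S := {j, k, l}) (by simp [hij, hik, hil])
    (Finset.card_le_three.trans_lt (by norm_num)) ?_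
  have h1 : a • d i = (-b) • d j + (-c) • d k + (-e) • d l := by
    rw [neg_smul, neg_smul, neg_smul, ← sub_eq_zero, ← h]
    abel
  rw [h1]
  exact Submodule.add_mem _ (Submodule.add_mem _
    (Submodule.smul_mem _ _ (Submodule.subset_span ⟨j, by simp, rfl⟩))
    (Submodule.smul_mem _ _ (Submodule.subset_span ⟨k, by simp, rfl⟩)))
    (Submodule.smul_mem _ _ (Submodule.subset_span ⟨l, by simp, rfl⟩))

lemma ne_zero (hd : IsArcFamily F 3 d) (i : ι) : d i ≠ 0 := fun h =>
  hd ∅ i (by simp) (by simp) (by simp [h])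

end IsArcFamily

/-! ### Automorphisms of the affine incidence graph -/

/-- The lines of the affine space `W` with direction in `d`. -/
abbrev DirectedLine (F : Type*) {W ι : Type*} [Field F] [AddCommGroup W] [Module F W]
    (d : ι → W) : Type _ :=
  Σ i, W ⧸ Submodule.span F {d i}

/-- The line through `x` in the direction of `d i`. -/
def lineThrough (F : Type*) {W ι : Type*} [Field F] [AddCommGroup W] [Module F W]
    (d : ι → W) (i : ι) (x : W) : DirectedLine F d :=
  ⟨i, Submodule.Quotient.mk x⟩

/-- The incidence graph of the points of `W` and the lines with direction in `d`. -/
def affGraph (F : Type*) {W ι : Type*} [Field F] [AddCommGroup W] [Module F W]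
    (d : ι → W) : SimpleGraph (W ⊕ DirectedLine F d) where
  Adj
    | .inl x, .inr L => lineThrough F d L.1 x = L
    | .inr L, .inl x => lineThrough F d L.1 x = L
    | _, _ => False
  symm := ⟨by rintro (x | L) (y | M) h <;> exact h⟩
  loopless := ⟨by rintro (x | L) h <;> exact h⟩

lemma exists_eq_lineThrough (L : DirectedLine F d) : ∃ x, L = lineThrough F d L.1 x := by
  obtain ⟨i, c⟩ := L
  obtain ⟨x, rfl⟩ := Submodule.Quotient.mk_surjective _ c
  exact ⟨x, rfl⟩

lemma lineThrough_eq_iff {i : ι} {x y : W} :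
    lineThrough F d i x = lineThrough F d i y ↔ ∃ t : F, x = y + t • d i := by
  simp only [lineThrough, Sigma.mk.injEq, heq_eq_eq, true_and]
  rw [Submodule.Quotient.eq, Submodule.mem_span_singleton]
  refine exists_congr fun t => ?_
  rw [eq_sub_iff_add_eq, add_comm, eq_comm]

lemma fst_eq_of_lineThrough_eq {i j : ι} {x y : W}
    (h : lineThrough F d i x = lineThrough F d j y) : i = j :=
  congrArg Sigma.fst h

lemma lineThrough_add_smul (i : ι) (x : W) (t : F) :
    lineThrough F d i (x + t • d i) = lineThrough F d i x :=
  lineThrough_eq_iff.2 ⟨t, rfl⟩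

lemma affGraph_adj {x : W} {L : DirectedLine F d} :
    (affGraph F d).Adj (.inl x) (.inr L) ↔ lineThrough F d L.1 x = L := Iff.rfl

lemma affGraph_adj_lineThrough (i : ι) (x : W) :
    (affGraph F d).Adj (.inl x) (.inr (lineThrough F d i x)) := rfl

lemma affGraph_isLeft_of_adj {u v : W ⊕ DirectedLine F d} (h : (affGraph F d).Adj u v) :
    u.isLeft = !v.isLeft := by
  rcases u with x | L <;> rcases v with y | M
  · exact h.elim
  · rfl
  · rfl
  · exact h.elim

/-- A property stable under moving in the directions `d i` holds everywhere. -/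
lemma forall_of_forall_add_smul (hspan : Submodule.span F (Set.range d) = ⊤) {p : W → Prop}
    (h : ∀ x (t : F) i, p x → p (x + t • d i)) {x : W} (hx : p x) (y : W) : p y := by
  have key : ∀ z ∈ Submodule.span F (Set.range d), ∀ (t : F) x, p x → p (x + t • z) := by
    intro z hz
    induction hz using Submodule.span_induction with
    | mem z hz =>
      obtain ⟨i, rfl⟩ := hz
      exact fun t x => h x t i
    | zero => simp
    | add z z' _ _ ih ih' =>
      intro t x hx
      rw [smul_add, ← add_assoc]
      exact ih' t _ (ih t x hx)
    | smul a z _ ih =>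
      intro t x hx
      rw [smul_smul]
      exact ih _ x hx
  have := key (y - x) (by rw [hspan]; trivial) 1 x hx
  simpa using this

/-- Two points on a common line have images adjacent to a common vertex, hence on the same side; the
spanning directions connect all points. -/
lemma isLeft_apply_inl_eq (hspan : Submodule.span F (Set.range d) = ⊤)
    (β : affGraph F d ≃g affGraph F d) (x : W) :
    (β (.inl x)).isLeft = (β (.inl 0)).isLeft := by
  refine forall_of_forall_add_smul hspan (p := fun x => (β (.inl x)).isLeft = (β (.inl 0)).isLeft)
    (fun x t i hx => ?_) rfl x
  have h1 := affGraph_isLeft_of_adj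
    (β.map_adj_iff.2 (affGraph_adj_lineThrough (F := F) (d := d) i x))
  have h2 := affGraph_isLeft_of_adj
    (β.map_adj_iff.2 (affGraph_adj_lineThrough (F := F) (d := d) i (x + t • d i)))
  rw [lineThrough_add_smul] at h2
  rw [h2, ← h1, hx]

lemma not_odd_card_of_involutive [Finite ι] {l : ι → ι} (hl : ∀ k, l (l k) = k)
    (hne : ∀ k, l k ≠ k) : ¬ Odd (Nat.card ι) := by
  have := Fintype.ofFinite ι
  have h : ∑ _k : ι, (1 : ZMod 2) = 0 :=
    Finset.sum_involution (fun k _ => l k) (fun _ _ => by decide) (fun k _ _ => hne k)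
      (fun _ _ => Finset.mem_univ _) (fun k _ => hl k)
  rw [Finset.sum_const, nsmul_one, Finset.card_univ, ← Nat.card_eq_fintype_card,
    ZMod.natCast_eq_zero_iff] at h
  rw [Nat.odd_iff]
  omega

/-- An automorphism of `affGraph` does not interchange points and lines. -/
lemma isLeft_apply_zero [Finite ι] (hd : IsArcFamily F 3 d)
    (hspan : Submodule.span F (Set.range d) = ⊤) (hι : 3 ≤ Nat.card ι)
    (hodd : IsArcFamily F 4 d ∨ Odd (Nat.card ι))
    (β : affGraph F d ≃g affGraph F d) : (β (.inl 0)).isLeft = true := by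
  classical
  by_contra hcon
  have hp : ∀ x, ∃ L, β (.inl x) = .inr L := by
    intro x
    have h := isLeft_apply_inl_eq hspan β x
    rw [Bool.eq_false_iff.2 hcon, Sum.isLeft_eq_false, Sum.isRight_iff] at h
    exact h
  choose p hp using hp
  have hP : ∀ L, ∃ x, β (.inr L) = .inl x := by
    intro L
    obtain ⟨x, hx⟩ := exists_eq_lineThrough L
    have h := affGraph_isLeft_of_adj (β.map_adj_iff.2 (affGraph_adj.2 hx.symm))
    rw [hp] at h
    rw [← Sum.isLeft_iff]
    simpa using h
  choose P hP using hP
  have hpinj : Function.Injective p := fun x y h => by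
    have : β (.inl x) = β (.inl y) := by rw [hp, hp, h]
    simpa using this
  have hPinj : Function.Injective P := fun x y h => by
    have : β (.inr x) = β (.inr y) := by rw [hP, hP, h]
    simpa using this
  have hinc : ∀ {x L}, lineThrough F d L.1 x = L ↔ lineThrough F d (p x).1 (P L) = p x := by
    intro x L
    rw [← affGraph_adj, ← affGraph_adj, ← β.map_adj_iff, hp, hP, SimpleGraph.adj_comm]
  have hinc' : ∀ i x, lineThrough F d (p x).1 (P (lineThrough F d i x)) = p x :=
    fun i x => hinc.1 rfl
  have hcol : ∀ i i' x, ∃ t : F,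
      P (lineThrough F d i x) = P (lineThrough F d i' x) + t • d (p x).1 := fun i i' x =>
    lineThrough_eq_iff.1 ((hinc' i x).trans (hinc' i' x).symm)
  have : Nontrivial ι := Finite.one_lt_card_iff_nontrivial.1 (by omega)
  obtain ⟨i, j, hij⟩ := exists_pair_ne ι
  have hL0 : lineThrough F d i (d i) = lineThrough F d i 0 := by
    simpa using lineThrough_add_smul (F := F) (d := d) i 0 1
  -- `A` and `B` are the images of two parallel lines in direction `j`, and `C` is the image of a
  -- line in direction `i` meeting both.
  set A := P (lineThrough F d j 0) with hA
  set B := P (lineThrough F d j (d i)) with hB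
  obtain ⟨a, ha⟩ := hcol j i 0
  obtain ⟨b, hb⟩ := hcol j i (d i)
  rw [hL0] at hb
  set C := P (lineThrough F d i 0) with hC
  have ha0 : a ≠ 0 := by
    rintro rfl
    rw [zero_smul, add_zero] at ha
    exact hij (fst_eq_of_lineThrough_eq (hPinj ha)).symm
  have hb0 : b ≠ 0 := by
    rintro rfl
    rw [zero_smul, add_zero] at hb
    exact hij (fst_eq_of_lineThrough_eq (hPinj hb)).symm
  have hkl : (p 0).1 ≠ (p (d i)).1 := by
    intro h
    have h1 := hinc' i 0
    have h2 := hinc' i (d i)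
    rw [hL0, ← h, h1] at h2
    exact hd.ne_zero i (hpinj h2).symm
  -- The line through `A` in direction `k` is the image of a point `x` on the first parallel. The
  -- `i`-line through `x` meets the second parallel in `x + d i`, whose image is a line through `B`;
  -- the image of that `i`-line is the common point.
  have hmeet : ∀ k, ∃ l, ∃ s t : F, A + s • d k = B + t • d l := by
    intro k
    obtain ⟨x, hx⟩ : ∃ x, p x = lineThrough F d k A := by
      have hsurj := β.surjective (.inr (lineThrough F d k A))
      rcases hsurj with ⟨x | L, h⟩
      · rw [hp] at h
        exact ⟨x, Sum.inr.inj h⟩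
      · rw [hP] at h
        cases h
    have hxM : lineThrough F d j x = lineThrough F d j 0 := by
      have h1 : lineThrough F d (p x).1 (P (lineThrough F d j 0)) = p x := by
        rw [hx]
        rfl
      exact hinc.2 h1
    obtain ⟨u, hu⟩ := lineThrough_eq_iff.1 hxM
    have hN : lineThrough F d j (x + d i) = lineThrough F d j (d i) :=
      lineThrough_eq_iff.2 ⟨u, by rw [hu, zero_add, add_comm]⟩
    have hL : lineThrough F d i (x + d i) = lineThrough F d i x := by
      simpa using lineThrough_add_smul (F := F) (d := d) i x 1
    obtain ⟨s, hs⟩ := hcol i j x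
    obtain ⟨t, ht⟩ := hcol i j (x + d i)
    rw [hL, hN] at ht
    rw [hxM] at hs
    have hk : (p x).1 = k := by rw [hx]; rfl
    rw [hk] at hs
    exact ⟨_, s, t, hs.symm.trans ht⟩
  rw [hA, hB, ha, hb] at hmeet
  generalize (p 0).1 = k' at *
  generalize (p (d i)).1 = l' at *
  rcases hodd with hd4 | hodd
  · obtain ⟨k, hk⟩ : ∃ k, k ∉ ({k', l'} : Finset ι) := by
      by_contra! h
      have := Fintype.ofFinite ι
      have h1 : (Finset.univ : Finset ι).card ≤ _ := Finset.card_le_card fun k _ => h k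
      rw [Finset.card_univ, ← Nat.card_eq_fintype_card] at h1
      have := Finset.card_le_two (a := k') (b := l')
      omega
    simp only [Finset.mem_insert, Finset.mem_singleton, not_or] at hk
    obtain ⟨l, s, t, h⟩ := hmeet k
    rw [← sub_eq_zero] at h
    rcases eq_or_ne l k' with rfl | hl
    · refine hb0 (neg_eq_zero.1 (hd4.coeff_eq_zero_of_four (i := l') (j := l) (k := k) (l := l)
        (a := -b) (b := a) (c := s) (e := -t) hkl.symm (Ne.symm hk.2) hkl.symm ?_))
      rw [← h]
      module
    · refine ha0 (hd4.coeff_eq_zero_of_four (i := k') (j := l') (k := k) (l := l)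
        (a := a) (b := -b) (c := s) (e := -t) hkl (Ne.symm hk.1) hl.symm ?_)
      rw [← h]
      module
  -- The vector from `A` to `B`, up to sign, is not a multiple of any direction, yet each `d k`
  -- spans with some `d (l k)` a plane containing it. Uniqueness of the partner makes `l` an
  -- involution without fixed points.
  · have hw : ∀ k (c : F), a • d k' - b • d l' ≠ c • d k := by
      intro k c h
      rw [← sub_eq_zero] at h
      rcases eq_or_ne k' k with rfl | hk
      · refine hb0 (neg_eq_zero.1 (hd.coeff_eq_zero_of_three (i := l') (j := k') (k := k')
          (a := -b) (b := a) (c := -c) hkl.symm hkl.symm ?_))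
        rw [← h]
        module
      · refine ha0 (hd.coeff_eq_zero_of_three (i := k') (j := l') (k := k)
          (a := a) (b := -b) (c := -c) hkl hk ?_)
        rw [← h]
        module
    choose l s t h using hmeet
    have h' : ∀ k, a • d k' - b • d l' = t k • d (l k) - s k • d k := by
      intro k
      have h1 := h k
      rw [← sub_eq_zero] at h1 ⊢
      rw [← h1]
      module
    have hlk : ∀ k, l k ≠ k := by
      intro k hk
      refine hw k (t k - s k) ?_
      rw [h' k, hk, sub_smul]
    refine not_odd_card_of_involutive (l := l) (fun k => ?_) hlk hodd
    by_contra hk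
    have h1 := h' (l k)
    have h2 : t (l k) = 0 := by
      refine hd.coeff_eq_zero_of_three (i := l (l k)) (j := k) (k := l k)
        (b := s k) (c := -(s (l k)) - t k) hk (hlk _) ?_
      have h3 := h1.symm.trans (h' k)
      rw [← sub_eq_zero] at h3
      rw [← h3]
      module
    rw [h2, zero_smul, zero_sub, ← neg_smul] at h1
    exact hw _ _ h1

/-- An automorphism of `affGraph` acts on the points, and maps parallel lines to parallel
lines. -/
theorem exists_apply_eq_lineThrough [Finite F] [Finite ι] (hd : IsArcFamily F 3 d)
    (hspan : Submodule.span F (Set.range d) = ⊤) (hι : 3 ≤ Nat.card ι)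
    (hιF : Nat.card ι = Nat.card F) (hodd : IsArcFamily F 4 d ∨ Odd (Nat.card ι))
    (β : affGraph F d ≃g affGraph F d) :
    ∃ (f : W → W) (π : ι → ι), Function.Injective f ∧ Function.Injective π ∧
      (∀ x, β (.inl x) = .inl (f x)) ∧
      ∀ i x, β (.inr (lineThrough F d i x)) = .inr (lineThrough F d (π i) (f x)) := by
  have hf : ∀ x, ∃ y, β (.inl x) = .inl y := fun x => by
    rw [← Sum.isLeft_iff, isLeft_apply_inl_eq hspan]
    exact isLeft_apply_zero hd hspan hι hodd β
  choose f hf using hf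
  have hg : ∀ i x, ∃ j, β (.inr (lineThrough F d i x)) = .inr (lineThrough F d j (f x)) := by
    intro i x
    have h := β.map_adj_iff.2 (affGraph_adj_lineThrough (F := F) (d := d) i x)
    have h1 := affGraph_isLeft_of_adj h
    rw [hf] at h h1
    obtain ⟨L, hL⟩ : ∃ L, β (.inr (lineThrough F d i x)) = .inr L := by
      rw [← Sum.isRight_iff, ← Sum.isLeft_eq_false]
      simpa using h1
    rw [hL, affGraph_adj] at h
    exact ⟨L.1, by rw [hL, h]⟩
  choose g hg using hg
  have hfi : Function.Injective f := fun x y h => by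
    have : β (.inl x) = β (.inl y) := by rw [hf, hf, h]
    simpa using this
  have hgne : ∀ i j x, i ≠ j → g i x ≠ g j x := by
    intro i j x hij h
    have h1 : β (.inr (lineThrough F d i x)) = β (.inr (lineThrough F d j x)) := by
      rw [hg, hg, h]
    exact hij (fst_eq_of_lineThrough_eq (Sum.inr.inj (β.injective h1)))
  have hline : ∀ i x (t : F), lineThrough F d (g i (x + t • d i)) (f (x + t • d i))
      = lineThrough F d (g i x) (f x) := by
    intro i x t
    have h := congrArg β (congrArg Sum.inr (lineThrough_add_smul (F := F) (d := d) i x t))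
    rw [hg, hg] at h
    exact Sum.inr.inj h
  have hgl : ∀ i x (t : F), g i (x + t • d i) = g i x := fun i x t =>
    fst_eq_of_lineThrough_eq (hline i x t)
  have hfl : ∀ i x (t : F), ∃ s : F, f (x + t • d i) = f x + s • d (g i x) := by
    intro i x t
    have h := hline i x t
    rw [hgl] at h
    exact lineThrough_eq_iff.1 h
  have hpar : ∀ j x (t : F) i, g j (x + t • d i) = g j x := by
    intro j x t i
    rcases eq_or_ne t 0 with rfl | ht
    · simp
    rcases eq_or_ne i j with rfl | hij
    · exact hgl i x t
    by_contra hcon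
    obtain ⟨a, ha⟩ := hfl i x t
    have ha0 : a ≠ 0 := by
      rintro rfl
      rw [zero_smul, add_zero] at ha
      have := hfi ha
      rw [add_eq_left, smul_eq_zero] at this
      exact this.elim ht (hd.ne_zero i)
    have h1 : g i x ≠ g j x := hgne i j x hij
    have h2 : g i x ≠ g j (x + t • d i) := by
      rw [← hgl i x t]
      exact hgne i j _ hij
    -- every point of one line is collinear to a point of the other
    have hmeet : ∀ s : F, ∃ l, ∃ u c : F,
        a • d (g i x) + u • d (g j (x + t • d i)) = s • d (g j x) + c • d l := by
      intro s
      have hmem : ∃ v : F, f (x + v • d j) = f x + s • d (g j x) := by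
        have hinj : Function.Injective fun v : F => (hfl j x v).choose := by
          intro v v' hv
          have e1 := (hfl j x v).choose_spec
          have e2 := (hfl j x v').choose_spec
          simp only at hv
          rw [hv, ← e2] at e1
          have := hfi e1
          rw [add_right_inj] at this
          exact smul_left_injective F (hd.ne_zero j) this
        obtain ⟨v, hv⟩ := (Finite.injective_iff_surjective.1 hinj) s
        exact ⟨v, by rw [(hfl j x v).choose_spec]; simp only at hv; rw [hv]⟩
      obtain ⟨v, hv⟩ := hmem
      obtain ⟨c, hc⟩ := hfl i (x + v • d j) t
      obtain ⟨u, hu⟩ := hfl j (x + t • d i) v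
      have hcomm : x + v • d j + t • d i = x + t • d i + v • d j := by abel
      rw [hcomm, hu, ha, hv, add_assoc, add_assoc, add_right_inj] at hc
      exact ⟨_, u, c, hc⟩
    -- `l s` is the direction of the transversal through the point with parameter `s`. It never
    -- equals `g j x` and is injective in `s`, contradicting the equality of the numbers of scalars
    -- and directions.
    choose l u c hmeet using hmeet
    have hlj : ∀ s, l s ≠ g j x := by
      intro s hs
      have h3 := hmeet s
      rw [hs, ← sub_eq_zero] at h3
      refine ha0 (hd.coeff_eq_zero_of_three (b := u s) (c := -s - c s) h2 h1 ?_)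
      rw [← h3]
      module
    have hlinj : Function.Injective l := by
      intro s s' hs
      have e1 := hmeet s
      have e2 := hmeet s'
      rw [hs] at e1
      rw [← sub_eq_zero] at e1 e2
      -- Cross-multiplication eliminates the supposedly common direction `d (l s')`, leaving a
      -- relation between three distinct directions.
      have e3 : ((c s' - c s) * a) • d (g i x)
          + (c s' * u s - c s * u s') • d (g j (x + t • d i))
          + (c s * s' - c s' * s) • d (g j x) = 0 := by
        linear_combination (norm := module) c s' • e1 - c s • e2
      have hc : c s' = c s := by
        have := hd.coeff_eq_zero_of_three h2 h1 e3
        exact sub_eq_zero.1 ((mul_eq_zero.1 this).resolve_right ha0)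
      have e4 : (c s * s' - c s' * s) • d (g j x) + ((c s' - c s) * a) • d (g i x)
          + (c s' * u s - c s * u s') • d (g j (x + t • d i)) = 0 := by
        rw [← e3]
        abel
      have h5 := hd.coeff_eq_zero_of_three h1.symm (Ne.symm hcon) e4
      rw [hc, ← mul_sub] at h5
      rcases mul_eq_zero.1 h5 with h6 | h6
      · have h7 : a • d (g i x) + u s • d (g j (x + t • d i)) + (-s) • d (g j x) = 0 := by
          rw [← e1, h6]
          module
        exact absurd (hd.coeff_eq_zero_of_three h2 h1 h7) ha0
      · exact (sub_eq_zero.1 h6).symm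
    obtain ⟨s, hs⟩ := (hlinj.bijective_of_nat_card_le hιF.le).2 (g j x)
    exact hlj s hs
  have hconst : ∀ j x, g j x = g j 0 := fun j x =>
    forall_of_forall_add_smul hspan (p := fun x => g j x = g j 0)
      (fun x t i hx => by rw [hpar, hx]) rfl x
  refine ⟨f, fun i => g i 0, hfi, fun i j h => ?_, hf, fun i x => by rw [hg, hconst]⟩
  by_contra hij
  exact hgne i j 0 hij h

end AffineModel

/-! ### From the projective setting to the affine model -/

section ProjectivePoints

variable {F V : Type*} [Field F] [AddCommGroup V] [Module F V]

lemma mk_mem_pointsOf {W : Submodule F V} {v : V} (hv : v ≠ 0) :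
    Projectivization.mk F v hv ∈ pointsOf W ↔ v ∈ W := by
  change (Projectivization.mk F v hv).submodule ≤ W ↔ _
  rw [Projectivization.submodule_mk, Submodule.span_singleton_le_iff_mem]

lemma mem_pointsOf_iff_rep_mem {W : Submodule F V} {P : ℙ F V} : P ∈ pointsOf W ↔ P.rep ∈ W := by
  rw [← mk_mem_pointsOf P.rep_nonzero, P.mk_rep]

lemma pointsOf_injective : Function.Injective (pointsOf : Submodule F V → Set (ℙ F V)) := by
  intro W W' h
  ext v
  rcases eq_or_ne v 0 with rfl | hv
  · simp
  · rw [← mk_mem_pointsOf hv, h, mk_mem_pointsOf hv]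

variable {H : Submodule F V} {K : Set (ℙ F V)}

/-- Vectors of `H` representing the points of `K`. -/
noncomputable def arcVec (hK : K ⊆ pointsOf H) (P : K) : H :=
  ⟨P.1.rep, mem_pointsOf_iff_rep_mem.1 (hK P.2)⟩

/-- A dependence among few points is enlarged to exactly `finrank H` points of `K`. Their vectors
still lie in the span of all but one of them, a proper subspace, and hence in a hyperplane of `H`.
-/
lemma IsArc.isArcFamily [FiniteDimensional F V] {k : ℕ} (hK : IsArc H k K) :
    IsArcFamily F (Module.finrank F H) (arcVec hK.subset) := by
  classical
  intro S m hm hS hmem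
  have hKfin : K.Finite := Set.finite_of_encard_eq_coe hK.encard_eq
  have : Fintype K := hKfin.fintype
  have hcard : Module.finrank F H ≤ Fintype.card K := by
    have h := hK.encard_eq
    rw [← Set.coe_fintypeCard, Nat.cast_inj] at h
    rw [h]
    exact hK.le_card
  obtain ⟨T, hST, hT⟩ := Finset.exists_superset_card_eq (s := insert m S)
    (by rw [Finset.card_insert_of_notMem hm]; exact hS) hcard
  set U := Submodule.span F (arcVec hK.subset '' ((T.erase m : Finset K) : Set K)) with hU
  have hmT : m ∈ T := hST (Finset.mem_insert_self m S)
  have hTU : ∀ P ∈ T, arcVec hK.subset P ∈ U := by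
    intro P hP
    rcases eq_or_ne P m with rfl | hne
    · refine Submodule.span_mono (Set.image_mono ?_) hmem
      intro Q hQ
      simp only [Finset.coe_erase, Set.mem_sdiff, Finset.mem_coe, Set.mem_singleton_iff]
      exact ⟨hST (Finset.mem_insert_of_mem hQ), fun h => hm (h ▸ hQ)⟩
    · exact Submodule.subset_span ⟨P, by simpa using ⟨hP, hne⟩, rfl⟩
  have hUtop : U < ⊤ := by
    rw [lt_top_iff_ne_top]
    intro h
    have h1 : Module.finrank F U ≤ (T.erase m).card := by
      rw [hU, ← Finset.coe_image]
      exact (finrank_span_finset_le_card _).trans Finset.card_image_le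
    rw [h, finrank_top] at h1
    have := Finset.card_erase_lt_of_mem hmT
    omega
  obtain ⟨ψ, hψ, hψU⟩ := Submodule.exists_le_ker_of_lt_top U hUtop
  have hker := Module.Dual.finrank_ker_add_one_of_ne_zero (f := ψ) hψ
  refine hK.not_subset_hyperplane ((LinearMap.ker ψ).map H.subtype)
    (Submodule.map_subtype_le H _) ?_ (T.map (Function.Embedding.subtype _)) ?_ ?_ ?_
  · rw [← hker, LinearEquiv.finrank_eq (Submodule.equivSubtypeMap H (LinearMap.ker ψ))]
  · intro P hP
    simp only [Finset.coe_map, Function.Embedding.subtype_apply, Set.mem_image] at hP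
    obtain ⟨Q, -, rfl⟩ := hP
    exact Q.2
  · rw [Finset.card_map, hT]
  · intro P hP
    simp only [Finset.coe_map, Function.Embedding.subtype_apply, Set.mem_image] at hP
    obtain ⟨Q, hQ, rfl⟩ := hP
    rw [mem_pointsOf_iff_rep_mem]
    exact ⟨arcVec hK.subset Q, hψU (hTU Q hQ), rfl⟩

lemma IsArcFamily.span_range_eq_top {W ι : Type*} [AddCommGroup W] [Module F W] [Finite ι]
    {r : ℕ} {d : ι → W} (hd : IsArcFamily F r d) (hr : 0 < r) (hW : Module.finrank F W = r)
    (hι : r ≤ Nat.card ι) :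
    Submodule.span F (Set.range d) = ⊤ := by
  have := Fintype.ofFinite ι
  have : Nonempty (Fin r) := ⟨⟨0, hr⟩⟩
  obtain ⟨b⟩ : Nonempty (Fin r ↪ ι) := by
    refine Function.Embedding.nonempty_of_card_le ?_
    rwa [Fintype.card_fin, ← Nat.card_eq_fintype_card]
  have h := (hd.linearIndependent_comp b.injective (by simp)).span_eq_top_of_card_eq_finrank
    (by simp [hW])
  rw [eq_top_iff, ← h]
  exact Submodule.span_mono (Set.range_comp_subset_range _ _)

/-- The isomorphism between the incidence graph of the affine points and lines with direction in
`K` and the linear representation graph, determined by the choice of an origin `e₀`. -/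
theorem exists_affGraph_iso (hK : K ⊆ pointsOf H) {ℓ : V →ₗ[F] F} (hℓ : ∀ v, v ∈ H ↔ ℓ v = 0)
    {e₀ : V} (he : ℓ e₀ = 1) :
    ∃ Θ : affGraph F (arcVec hK) ≃g linRepGraph H K,
      (∀ x : H, ∃ P : AffinePoint H, Θ (.inl x) = .inl P ∧
        ∃ h, P.1 = Projectivization.mk F (e₀ + x) h) ∧
      ∀ (Q : K) (x : H), ∃ L : RepLine H K, Θ (.inr (lineThrough F (arcVec hK) Q x)) = .inr L ∧
        ∀ v, v ∈ L.1 ↔ ∃ t : F, v = ℓ v • (e₀ + (x : V)) + t • Q.1.rep := by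
  have hH : ∀ x : H, ℓ x = 0 := fun x => (hℓ x).1 x.2
  have hrep : ∀ Q : K, ℓ Q.1.rep = 0 := fun Q => hH (arcVec hK Q)
  have hpt : ∀ x : H, ℓ (e₀ + x) = 1 := fun x => by rw [map_add, he, hH, add_zero]
  have hne : ∀ x : H, e₀ + (x : V) ≠ 0 := fun x h => by
    have := hpt x
    rw [h, map_zero] at this
    exact zero_ne_one this
  have hnm : ∀ x : H, e₀ + (x : V) ∉ H := fun x h => by
    rw [hℓ, hpt] at h
    exact one_ne_zero h
  -- The chart `ℓ = 1`: every point outside `H` has a unique representative of the form `e₀ + x`.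
  let pt : H → AffinePoint H := fun x =>
    ⟨Projectivization.mk F (e₀ + x) (hne x), by rw [mk_mem_pointsOf]; exact hnm x⟩
  have hptbij : Function.Bijective pt := by
    constructor
    · intro x y h
      have h1 := congrArg Subtype.val h
      rw [Projectivization.mk_eq_mk_iff'] at h1
      obtain ⟨a, ha⟩ := h1
      have h2 := congrArg ℓ ha
      rw [map_smul, hpt, hpt, smul_eq_mul, mul_one] at h2
      rw [h2, one_smul, add_right_inj] at ha
      exact Subtype.ext ha.symm
    · rintro ⟨P, hP⟩
      induction P using Projectivization.ind with
      | h v hv =>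
        rw [mk_mem_pointsOf, hℓ] at hP
        refine ⟨⟨(ℓ v)⁻¹ • v - e₀, by simp [hℓ, he, hP]⟩, Subtype.ext ?_⟩
        rw [Projectivization.mk_eq_mk_iff']
        exact ⟨(ℓ v)⁻¹, by simp⟩
  let S : DirectedLine F (arcVec hK) → Submodule F V := fun L =>
    Submodule.span F {e₀ + (L.2.out : V), L.1.1.rep}
  -- `S` uses a chosen coset representative; this description holds for every representative `x`.
  have hS : ∀ (Q : K) (x : H) (v : V), v ∈ S (lineThrough F (arcVec hK) Q x) ↔
      ∃ t : F, v = ℓ v • (e₀ + (x : V)) + t • Q.1.rep := by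
    intro Q x v
    set c : H ⧸ Submodule.span F {arcVec hK Q} := Submodule.Quotient.mk x with hc
    obtain ⟨u, hu⟩ : ∃ u : F, u • arcVec hK Q = x - c.out := by
      rw [← Submodule.mem_span_singleton, ← Submodule.Quotient.eq, ← hc]
      exact (Quotient.out_eq' c).symm
    have hu' : (x : V) = c.out + u • Q.1.rep := by
      have h1 := congrArg (Subtype.val) hu
      have h2 : (u • Q.1.rep : V) = x - c.out := h1
      rw [h2]
      abel
    change v ∈ Submodule.span F {e₀ + (c.out : V), Q.1.rep} ↔ _
    rw [Submodule.mem_span_pair]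
    constructor
    · rintro ⟨a, b, rfl⟩
      refine ⟨b - a * u, ?_⟩
      rw [map_add, map_smul, map_smul, hpt, hrep, hu']
      simp only [smul_eq_mul, mul_one, mul_zero, add_zero]
      module
    · rintro ⟨t, ht⟩
      refine ⟨ℓ v, t + ℓ v * u, ?_⟩
      nth_rewrite 3 [ht]
      rw [hu']
      module
  have hS2 : ∀ L, Module.finrank F (S L) = 2 := by
    intro L
    have hli : LinearIndependent F ![e₀ + (L.2.out : V), L.1.1.rep] := by
      rw [LinearIndependent.pair_iff]
      intro a b hab
      have h1 := congrArg ℓ hab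
      rw [map_add, map_smul, map_smul, hpt, hrep] at h1
      have h2 : a = 0 := by simpa using h1
      refine ⟨h2, ?_⟩
      rw [h2, zero_smul, zero_add] at hab
      exact (smul_eq_zero.1 hab).resolve_right (Projectivization.rep_nonzero _)
    have h := finrank_span_eq_card hli
    rwa [Matrix.range_cons_cons_empty, Fintype.card_fin] at h
  let ln : DirectedLine F (arcVec hK) → RepLine H K := fun L =>
    ⟨S L, hS2 L, ⟨L.1.1, L.1.2, mem_pointsOf_iff_rep_mem.2 (Submodule.subset_span (by simp))⟩,
      fun h => hnm L.2.out (h (Submodule.subset_span (by simp)))⟩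
  have hmem : ∀ (Q : K) (x y : H), e₀ + (y : V) ∈ S (lineThrough F (arcVec hK) Q x) ↔
      lineThrough F (arcVec hK) Q y = lineThrough F (arcVec hK) Q x := by
    intro Q x y
    rw [hS, lineThrough_eq_iff, hpt]
    refine exists_congr fun t => ?_
    rw [one_smul, add_assoc, add_right_inj, ← Subtype.coe_inj]
    rfl
  have hlnbij : Function.Bijective ln := by
    constructor
    · intro L M h
      have h : S L = S M := congrArg Subtype.val h
      obtain ⟨x, hx⟩ := exists_eq_lineThrough L
      obtain ⟨y, hy⟩ := exists_eq_lineThrough M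
      have h1 : L.1.1.rep ∈ S M := h ▸ Submodule.subset_span (by simp)
      rw [hy, hS, hrep] at h1
      obtain ⟨t, ht⟩ := h1
      rw [zero_smul, zero_add] at ht
      have h2 : L.1 = M.1 := by
        refine Subtype.ext ?_
        rw [← L.1.1.mk_rep, ← M.1.1.mk_rep, Projectivization.mk_eq_mk_iff']
        exact ⟨t, ht.symm⟩
      rw [hx, hy, h2, ← hmem, ← hy, ← h, hx, hmem]
    · rintro ⟨L, hL2, ⟨Q, hQK, hQL⟩, hLH⟩
      obtain ⟨v, hvL, hvH⟩ := SetLike.not_le_iff_exists.1 hLH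
      rw [hℓ] at hvH
      set x : H := ⟨(ℓ v)⁻¹ • v - e₀, by simp [hℓ, he, hvH]⟩ with hx
      refine ⟨lineThrough F (arcVec hK) ⟨Q, hQK⟩ x, Subtype.ext ?_⟩
      have : FiniteDimensional F L := FiniteDimensional.of_finrank_pos (by omega)
      refine Submodule.eq_of_le_of_finrank_eq (fun w hw => ?_) ((hS2 _).trans hL2.symm)
      obtain ⟨t, ht⟩ := (hS _ _ _).1 hw
      rw [ht]
      refine L.add_mem (L.smul_mem _ ?_) (L.smul_mem _ (mem_pointsOf_iff_rep_mem.1 hQL))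
      have : e₀ + (x : V) = (ℓ v)⁻¹ • v := by simp [hx]
      rw [this]
      exact L.smul_mem _ hvL
  refine ⟨⟨Equiv.sumCongr (Equiv.ofBijective pt hptbij) (Equiv.ofBijective ln hlnbij), ?_⟩,
    fun x => ⟨pt x, rfl, hne x, rfl⟩,
    fun Q x => ⟨ln (lineThrough F (arcVec hK) Q x), rfl, fun v => hS Q x v⟩⟩
  have hadj : ∀ (x : H) (L : DirectedLine F (arcVec hK)),
      (pt x).1 ∈ pointsOf (ln L).1 ↔ lineThrough F (arcVec hK) L.1 x = L := by
    intro x L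
    obtain ⟨y, hy⟩ := exists_eq_lineThrough L
    rw [mk_mem_pointsOf]
    change _ ∈ S L ↔ _
    nth_rewrite 1 [hy]
    rw [hmem, ← hy]
  rintro (x | L) (y | M)
  · exact Iff.rfl
  · exact hadj x M
  · exact hadj y L
  · exact Iff.rfl

end ProjectivePoints

/-! ### Collineations and the automorphisms they induce -/

section Collineations

variable {F V : Type*} [Field F] [AddCommGroup V] [Module F V]

/-- The image of a linear subspace under a semilinear bijection. -/
def semilinearImage (σ : F ≃+* F) (φ : V ≃+ V) (hφ : ∀ (c : F) (v : V), φ (c • v) = σ c • φ v)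
    (L : Submodule F V) : Submodule F V where
  carrier := φ '' L
  zero_mem' := ⟨0, L.zero_mem, map_zero φ⟩
  add_mem' := by
    rintro _ _ ⟨v, hv, rfl⟩ ⟨w, hw, rfl⟩
    exact ⟨v + w, L.add_mem hv hw, map_add φ v w⟩
  smul_mem' := by
    rintro c _ ⟨v, hv, rfl⟩
    exact ⟨σ.symm c • v, L.smul_mem _ hv, by rw [hφ, σ.apply_symm_apply]⟩

section

variable {σ : F ≃+* F} {φ : V ≃+ V} {hφ : ∀ (c : F) (v : V), φ (c • v) = σ c • φ v}
  {L : Submodule F V}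

lemma apply_mem_semilinearImage {v : V} : φ v ∈ semilinearImage σ φ hφ L ↔ v ∈ L :=
  φ.injective.mem_set_image

/-- `φ` is not linear in general, so dimensions are compared by counting vectors. -/
lemma finrank_semilinearImage [Finite F] [Finite V] :
    Module.finrank F (semilinearImage σ φ hφ L) = Module.finrank F L := by
  have h : Nat.card (semilinearImage σ φ hφ L) = Nat.card L :=
    Nat.card_image_of_injective φ.injective (L : Set V)
  rw [Module.natCard_eq_pow_finrank (K := F)
    (V := semilinearImage σ φ hφ L), Module.natCard_eq_pow_finrank (K := F) (V := L)] at h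
  exact Nat.pow_right_injective Finite.one_lt_card h

lemma semilinearImage_injective : Function.Injective (semilinearImage σ φ hφ) := by
  intro L M h
  ext v
  rw [← apply_mem_semilinearImage (hφ := hφ), h, apply_mem_semilinearImage]

lemma apply_mem_pointsOf_semilinearImage {g : Equiv.Perm (ℙ F V)}
    (hg : ∀ (v : V) (hv : v ≠ 0),
      g (Projectivization.mk F v hv) = Projectivization.mk F (φ v) (φ.map_ne_zero_iff.2 hv))
    {P : ℙ F V} : g P ∈ pointsOf (semilinearImage σ φ hφ L) ↔ P ∈ pointsOf L := by
  induction P using Projectivization.ind with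
  | h v hv => rw [hg, mk_mem_pointsOf, mk_mem_pointsOf, apply_mem_semilinearImage]

lemma pointsOf_semilinearImage {g : Equiv.Perm (ℙ F V)}
    (hg : ∀ (v : V) (hv : v ≠ 0),
      g (Projectivization.mk F v hv) = Projectivization.mk F (φ v) (φ.map_ne_zero_iff.2 hv)) :
    pointsOf (semilinearImage σ φ hφ L) = g '' pointsOf L := by
  ext P
  obtain ⟨P, rfl⟩ := g.surjective P
  rw [apply_mem_pointsOf_semilinearImage hg, g.injective.mem_set_image]

end

lemma exists_mem_PGammaL [Finite V] (σ : F ≃+* F) (φ : V ≃+ V)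
    (hφ : ∀ (c : F) (v : V), φ (c • v) = σ c • φ v) :
    ∃ g ∈ PGammaL F V, ∀ (v : V) (hv : v ≠ 0),
      g (Projectivization.mk F v hv) = Projectivization.mk F (φ v) (φ.map_ne_zero_iff.2 hv) := by
  let ψ : V →ₛₗ[(σ : F →+* F)] V := { φ with map_smul' := hφ }
  have hψ : Function.Injective ψ := φ.injective
  have : RingHomInvPair (σ : F →+* F) (σ.symm : F →+* F) := RingHomInvPair.of_ringEquiv σ
  have hbij := Finite.injective_iff_bijective.1
    (Projectivization.map_injective (τ := (σ.symm : F →+* F)) ψ hψ)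
  exact ⟨Equiv.ofBijective _ hbij, ⟨σ, φ, hφ, fun v hv => rfl⟩, fun v hv => rfl⟩

variable {H : Submodule F V} {K : Set (ℙ F V)}

lemma apply_mem_iff_of_mem_stabilizer {g : PGammaL F V}
    (hg : g ∈ MulAction.stabilizer (PGammaL F V) K) (P : ℙ F V) :
    (g : Equiv.Perm (ℙ F V)) P ∈ K ↔ P ∈ K := by
  rw [MulAction.mem_stabilizer_iff] at hg
  exact (show g • P ∈ K ↔ P ∈ K by
    nth_rewrite 1 [← hg]
    exact Set.smul_mem_smul_set_iff)

/-- A semilinear map preserving a set of points spanning `H` preserves `H`. -/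
lemma apply_mem_iff_of_span_eq_top [Finite V] (hK : K ⊆ pointsOf H)
    (hspan : Submodule.span F (Set.range (arcVec hK)) = ⊤)
    {σ : F ≃+* F} {φ : V ≃+ V} (hφ : ∀ (c : F) (v : V), φ (c • v) = σ c • φ v)
    {g : Equiv.Perm (ℙ F V)}
    (hg : ∀ (v : V) (hv : v ≠ 0),
      g (Projectivization.mk F v hv) = Projectivization.mk F (φ v) (φ.map_ne_zero_iff.2 hv))
    (hgK : ∀ P, g P ∈ K ↔ P ∈ K) (v : V) : φ v ∈ H ↔ v ∈ H := by
  have h1 : ∀ x ∈ Submodule.span F (Set.range (arcVec hK)), φ (x : V) ∈ H := by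
    intro x hx
    induction hx using Submodule.span_induction with
    | mem x hx =>
      obtain ⟨P, rfl⟩ := hx
      have h2 := hK ((hgK P.1).2 P.2)
      rw [← P.1.mk_rep, hg, mk_mem_pointsOf] at h2
      exact h2
    | zero => simp
    | add x y _ _ ihx ihy => simpa using H.add_mem ihx ihy
    | smul a x _ ih =>
      rw [Submodule.coe_smul, hφ]
      exact H.smul_mem _ ih
  rw [hspan] at h1
  let r : H → H := fun x => ⟨φ x, h1 x trivial⟩
  have hr : Function.Injective r := fun x y h =>
    Subtype.ext (φ.injective (congrArg Subtype.val h))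
  refine ⟨fun hv => ?_, fun hv => h1 ⟨v, hv⟩ trivial⟩
  obtain ⟨u, hu⟩ := Finite.injective_iff_surjective.1 hr ⟨φ v, hv⟩
  rw [← φ.injective (congrArg Subtype.val hu)]
  exact u.2

/-- A collineation preserving `H` and `K` induces an automorphism of the linear representation
graph. -/
lemma exists_isInducedBy [Finite F] [Finite V]
    {σ : F ≃+* F} {φ : V ≃+ V} (hφ : ∀ (c : F) (v : V), φ (c • v) = σ c • φ v)
    {g : Equiv.Perm (ℙ F V)}
    (hg : ∀ (v : V) (hv : v ≠ 0),
      g (Projectivization.mk F v hv) = Projectivization.mk F (φ v) (φ.map_ne_zero_iff.2 hv))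
    (hgK : ∀ P, g P ∈ K ↔ P ∈ K) (hH : ∀ v, φ v ∈ H ↔ v ∈ H) :
    ∃ α : linRepGraph H K ≃g linRepGraph H K, IsInducedBy α g := by
  have hgH : ∀ P, g P ∈ pointsOf H ↔ P ∈ pointsOf H := by
    intro P
    induction P using Projectivization.ind with
    | h v hv => rw [hg, mk_mem_pointsOf, mk_mem_pointsOf, hH]
  let a : AffinePoint H → AffinePoint H := fun P => ⟨g P.1, fun h => P.2 ((hgH _).1 h)⟩
  have ha : Function.Injective a := fun P Q h =>
    Subtype.ext (g.injective (congrArg Subtype.val h))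
  let b : RepLine H K → RepLine H K := fun L =>
    ⟨semilinearImage σ φ hφ L.1, finrank_semilinearImage.trans L.2.1, by
      obtain ⟨P, hP, hPL⟩ := L.2.2.1
      exact ⟨g P, (hgK P).2 hP, (apply_mem_pointsOf_semilinearImage hg).2 hPL⟩, by
      obtain ⟨v, hv, hvH⟩ := SetLike.not_le_iff_exists.1 L.2.2.2
      exact fun h => hvH ((hH v).1 (h (apply_mem_semilinearImage.2 hv)))⟩
  have hb : Function.Injective b := fun L M h =>
    Subtype.ext (semilinearImage_injective (hφ := hφ) (congrArg Subtype.val h))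
  have : Finite (AffinePoint H) := inferInstanceAs (Finite {P : ℙ F V // P ∉ pointsOf H})
  have : Finite (RepLine H K) := inferInstanceAs (Finite {L : Submodule F V //
    Module.finrank F L = 2 ∧ (∃ P ∈ K, P ∈ pointsOf L) ∧ ¬ L ≤ H})
  refine ⟨⟨Equiv.sumCongr (Equiv.ofBijective a (Finite.injective_iff_bijective.1 ha))
    (Equiv.ofBijective b (Finite.injective_iff_bijective.1 hb)), ?_⟩,
    fun P => ⟨a P, rfl, rfl⟩, fun L => ⟨b L, rfl, pointsOf_semilinearImage (hφ := hφ) hg⟩⟩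
  rintro (P | L) (Q | M)
  · exact Iff.rfl
  · exact apply_mem_pointsOf_semilinearImage (hφ := hφ) hg
  · exact apply_mem_pointsOf_semilinearImage (hφ := hφ) hg
  · exact Iff.rfl

lemma IsInducedBy.unique {α α' : linRepGraph H K ≃g linRepGraph H K} {g : Equiv.Perm (ℙ F V)}
    (h : IsInducedBy α g) (h' : IsInducedBy α' g) : α = α' := by
  refine RelIso.ext fun u => ?_
  rcases u with P | L
  · obtain ⟨Q, hQ, e⟩ := h.1 P
    obtain ⟨Q', hQ', e'⟩ := h'.1 P
    rw [hQ, hQ', Subtype.ext (e.trans e'.symm)]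
  · obtain ⟨M, hM, e⟩ := h.2 L
    obtain ⟨M', hM', e'⟩ := h'.2 L
    rw [hM, hM', Subtype.ext (pointsOf_injective (e.trans e'.symm))]

lemma IsInducedBy.mul {α α' : linRepGraph H K ≃g linRepGraph H K} {g g' : Equiv.Perm (ℙ F V)}
    (h : IsInducedBy α g) (h' : IsInducedBy α' g') : IsInducedBy (α * α') (g * g') := by
  refine ⟨fun P => ?_, fun L => ?_⟩
  · obtain ⟨Q, hQ, e⟩ := h'.1 P
    obtain ⟨R, hR, e'⟩ := h.1 Q
    exact ⟨R, by rw [RelIso.mul_apply, hQ, hR], by rw [e', e, Equiv.Perm.mul_apply]⟩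
  · obtain ⟨Q, hQ, e⟩ := h'.2 L
    obtain ⟨R, hR, e'⟩ := h.2 Q
    exact ⟨R, by rw [RelIso.mul_apply, hQ, hR], by rw [e', e, Equiv.Perm.coe_mul, Set.image_comp]⟩

/-- A collineation preserving `H` is determined by its action on the affine points. -/
lemma eq_of_isInducedBy {α : linRepGraph H K ≃g linRepGraph H K} (hHtop : H ≠ ⊤)
    {φ φ' : V ≃+ V} {g g' : Equiv.Perm (ℙ F V)}
    (hg : ∀ (v : V) (hv : v ≠ 0),
      g (Projectivization.mk F v hv) = Projectivization.mk F (φ v) (φ.map_ne_zero_iff.2 hv))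
    (hg' : ∀ (v : V) (hv : v ≠ 0),
      g' (Projectivization.mk F v hv) = Projectivization.mk F (φ' v) (φ'.map_ne_zero_iff.2 hv))
    (hH : ∀ v, φ v ∈ H ↔ v ∈ H) (hH' : ∀ v, φ' v ∈ H ↔ v ∈ H)
    (h : IsInducedBy α g) (h' : IsInducedBy α g') : g = g' := by
  have haff : ∀ P ∉ pointsOf H, g P = g' P := by
    intro P hP
    obtain ⟨Q, hQ, e⟩ := h.1 ⟨P, hP⟩
    obtain ⟨Q', hQ', e'⟩ := h'.1 ⟨P, hP⟩
    rw [hQ] at hQ'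
    have e : Q.1 = g P := e
    have e' : Q'.1 = g' P := e'
    rw [← e, ← e', Sum.inl.inj hQ']
  have hvec : ∀ v ∉ H, ∃ c : F, c • φ' v = φ v := by
    intro v hv
    have hv0 : v ≠ 0 := fun h => hv (h ▸ H.zero_mem)
    have := haff (Projectivization.mk F v hv0) (by rwa [mk_mem_pointsOf])
    rw [hg, hg', Projectivization.mk_eq_mk_iff'] at this
    exact this
  obtain ⟨e₀, -, he₀⟩ := SetLike.exists_of_lt (lt_top_iff_ne_top.2 hHtop)
  refine Equiv.ext fun P => ?_
  by_cases hP : P ∈ pointsOf H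
  · induction P using Projectivization.ind with
    | h v hv =>
      rw [mk_mem_pointsOf] at hP
      obtain ⟨c, hc⟩ := hvec e₀ he₀
      obtain ⟨c', hc'⟩ := hvec (e₀ + v) (fun h => he₀ ((H.add_mem_iff_left hP).1 h))
      rw [map_add, map_add, ← hc, smul_add] at hc'
      -- The right side lies in `H` and `φ' e₀` does not, so the scalars at `e₀` and `e₀ + v` agree,
      -- and the same scalar relates `φ v` to `φ' v`.
      have h1 : (c' - c) • φ' e₀ = φ v - c' • φ' v := by
        rw [sub_smul, sub_eq_sub_iff_add_eq_add, hc', add_comm]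
      have h2 : (c' - c) • φ' e₀ ∈ H := by
        rw [h1]
        exact H.sub_mem ((hH v).2 hP) (H.smul_mem _ ((hH' v).2 hP))
      have h3 : c' - c = 0 := by
        by_contra h4
        exact he₀ ((hH' _).1 ((H.smul_mem_iff h4).1 h2))
      rw [hg, hg', Projectivization.mk_eq_mk_iff']
      exact ⟨c', by rw [h3, zero_smul] at h1; exact (sub_eq_zero.1 h1.symm).symm⟩
  · exact haff P hP

end Collineations

/-! ### Every graph automorphism comes from a collineation -/

section InducedAutomorphisms

variable {F V : Type*} [Field F] [AddCommGroup V] [Module F V] {H : Submodule F V}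
  {K : Set (ℙ F V)}

/-- A functional with kernel the hyperplane `H`, normalised at some vector `e₀`. -/
lemma exists_functional {n : ℕ} (hV : Module.finrank F V = n + 2)
    (hH : Module.finrank F H = n + 1) :
    ∃ (ℓ : V →ₗ[F] F) (e₀ : V), (∀ v, v ∈ H ↔ ℓ v = 0) ∧ ℓ e₀ = 1 := by
  have : FiniteDimensional F V := FiniteDimensional.of_finrank_pos (by omega)
  have hlt : H < ⊤ := by
    rw [lt_top_iff_ne_top]
    rintro rfl
    rw [finrank_top] at hH
    omega
  obtain ⟨ℓ, hℓ, hHℓ⟩ := Submodule.exists_le_ker_of_lt_top H hlt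
  have hker := Module.Dual.finrank_ker_add_one_of_ne_zero (f := ℓ) hℓ
  have heq : H = LinearMap.ker ℓ := Submodule.eq_of_le_of_finrank_eq hHℓ (by omega)
  obtain ⟨v, hv⟩ : ∃ v, ℓ v ≠ 0 := by
    by_contra! h
    exact hℓ (LinearMap.ext h)
  exact ⟨ℓ, (ℓ v)⁻¹ • v, fun w => by rw [heq, LinearMap.mem_ker], by simp [hv]⟩

/-- Semilinear bijections of `H` composed with translations extend to semilinear bijections of
`V`. -/
lemma exists_semilinear_extension [Finite V] {ℓ : V →ₗ[F] F} (hℓ : ∀ v, v ∈ H ↔ ℓ v = 0)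
    {e₀ : V} (he : ℓ e₀ = 1) {σ : F ≃+* F} {T : H → H} (hT : Function.Injective T)
    (hadd : ∀ x y, T (x + y) = T x + T y) (hsmul : ∀ (a : F) x, T (a • x) = σ a • T x) (w : H) :
    ∃ φ : V ≃+ V, (∀ (c : F) (v : V), φ (c • v) = σ c • φ v) ∧
      ∀ (c : F) (x : H), φ (c • e₀ + x) = σ c • (e₀ + (w : V)) + T x := by
  have hH : ∀ x : H, ℓ x = 0 := fun x => (hℓ x).1 x.2
  let p : V → H := fun v => ⟨v - ℓ v • e₀, by simp [hℓ, he]⟩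
  have hp : ∀ u v, p (u + v) = p u + p v := fun u v => Subtype.ext (by
    change u + v - ℓ (u + v) • e₀ = (u - ℓ u • e₀) + (v - ℓ v • e₀)
    rw [map_add]
    module)
  have hp' : ∀ (c : F) v, p (c • v) = c • p v := fun c v => Subtype.ext (by
    change c • v - ℓ (c • v) • e₀ = c • (v - ℓ v • e₀)
    rw [map_smul, smul_eq_mul]
    module)
  let φ : V →+ V := AddMonoidHom.mk' (fun v => σ (ℓ v) • (e₀ + (w : V)) + T (p v)) fun u v => by
    rw [hp, hadd, map_add, map_add, Submodule.coe_add]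
    module
  have hφ : ∀ v, φ v = σ (ℓ v) • (e₀ + (w : V)) + T (p v) := fun _ => rfl
  have hT0 : T 0 = 0 := by simpa using hadd 0 0
  have hinj : Function.Injective φ := by
    rw [injective_iff_map_eq_zero]
    intro v hv
    rw [hφ] at hv
    have h1 := congrArg ℓ hv
    rw [map_add, map_smul, map_add, he, hH, hH, map_zero] at h1
    have h2 : ℓ v = 0 := by simpa using h1
    rw [h2, map_zero, zero_smul, zero_add, Submodule.coe_eq_zero] at hv
    have h3 := congrArg Subtype.val (hT (hv.trans hT0.symm))
    simpa [p, h2] using h3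
  refine ⟨AddEquiv.ofBijective φ (Finite.injective_iff_bijective.1 hinj), fun c v => ?_,
    fun c x => ?_⟩
  · simp only [AddEquiv.ofBijective_apply, hφ]
    rw [hp', hsmul, map_smul, smul_eq_mul, map_mul, Submodule.coe_smul]
    module
  · simp only [AddEquiv.ofBijective_apply, hφ]
    have h1 : ℓ (c • e₀ + x) = c := by simp [he, hH]
    have h2 : p (c • e₀ + x) = x := Subtype.ext (by
      change c • e₀ + (x : V) - ℓ (c • e₀ + x) • e₀ = x
      rw [h1, add_sub_cancel_left])
    rw [h1, h2]

/-- Every automorphism of the linear representation graph of an arc is induced by a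
collineation. -/
theorem exists_isInducedBy_of_iso [Finite F] {n q : ℕ} (hq : Nat.card F = q)
    (hnq : ((n + 3 ≤ q ∨ (q = n + 2 ∧ q.Prime)) ∧ 3 ≤ n) ∨ (n = 2 ∧ Odd q))
    (hV : Module.finrank F V = n + 2) (hH : Module.finrank F H = n + 1) (hK : IsArc H q K)
    (α : linRepGraph H K ≃g linRepGraph H K) :
    ∃ g ∈ MulAction.stabilizer (PGammaL F V) K, IsInducedBy α (g : Equiv.Perm (ℙ F V)) := by
  have : FiniteDimensional F V := FiniteDimensional.of_finrank_pos (by omega)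
  have : Finite V := Module.finite_of_finite F
  have hcard : Nat.card K = Nat.card F := by
    rw [Nat.card_coe_set_eq, Set.ncard, hK.encard_eq, hq]
    rfl
  have hnq' : n + 1 ≤ q := hH ▸ hK.le_card
  have hd := hK.isArcFamily
  rw [hH] at hd
  have hspan := hd.span_range_eq_top (Nat.succ_pos n) hH (by omega)
  obtain ⟨ℓ, e₀, hℓ, he⟩ := exists_functional hV hH
  have hH0 : ∀ x : H, ℓ x = 0 := fun x => (hℓ x).1 x.2
  obtain ⟨Θ, hΘp, hΘl⟩ := exists_affGraph_iso hK.subset hℓ he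
  obtain ⟨f, π, hfi, hπ, hβp, hβl⟩ := exists_apply_eq_lineThrough (hd.mono (by omega)) hspan
    (by omega) hcard
    (by
      rcases hnq with ⟨-, h⟩ | ⟨-, h⟩
      · exact Or.inl (hd.mono (by omega))
      · exact Or.inr (by rwa [hcard, hq])) ((Θ.trans α).trans Θ.symm)
  have hαp : ∀ x, α (Θ (.inl x)) = Θ (.inl (f x)) := fun x => by
    rw [← hβp]
    simp
  have hαl : ∀ Q x, α (Θ (.inr (lineThrough F _ Q x))) = Θ (.inr (lineThrough F _ (π Q) (f x))) :=
    fun Q x => by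
      rw [← hβl]
      simp
  have hfline : ∀ x (t : F) Q, ∃ s : F,
      f (x + t • arcVec hK.subset Q) = f x + s • arcVec hK.subset (π Q) := by
    intro x t Q
    have h := congrArg (fun L => ((Θ.trans α).trans Θ.symm) (.inr L))
      (lineThrough_add_smul (F := F) (d := arcVec hK.subset) Q x t)
    simp only [hβl] at h
    exact lineThrough_eq_iff.1 (Sum.inr.inj h)
  -- The semilinearity theorem needs 0 fixed; the translation by `f 0` is restored in the extension
  -- to `V` as the `H`-component of the image of `e₀`.
  set T : H → H := fun x => f x - f 0 with hT
  have hTi : Function.Injective T := fun x y h => hfi (sub_left_injective h)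
  have hTline : ∀ x (t : F) Q, ∃ s : F,
      T (x + t • arcVec hK.subset Q) = T x + s • arcVec hK.subset (π Q) := by
    intro x t Q
    obtain ⟨s, hs⟩ := hfline x t Q
    exact ⟨s, by simp only [hT, hs]; abel⟩
  have hT0 : T 0 = 0 := sub_self _
  obtain ⟨σ, hadd, hsmul⟩ := hd.exists_semilinear (by omega) hH hcard
    (by
      rw [hq]
      rcases hnq with ⟨h | h, -⟩ | ⟨rfl, h⟩
      · exact Or.inl h
      · exact Or.inr (Or.inl h)
      -- For `n = 2`, an odd `q ≥ 3` is either 3, the basis case, or at least `5 = n + 3`.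
      · obtain ⟨k, hk⟩ := h
        omega) hTi hπ hT0 hTline
  obtain ⟨φ, hφ, hφv⟩ := exists_semilinear_extension hℓ he hTi hadd hsmul (f 0)
  obtain ⟨g, hgΓ, hg⟩ := exists_mem_PGammaL σ φ hφ
  have hφH : ∀ x : H, φ x = T x := fun x => by simpa using hφv 0 x
  have hφp : ∀ x : H, φ (e₀ + x) = e₀ + f x := fun x => by
    have := hφv 1 x
    rw [one_smul, map_one, one_smul] at this
    rw [this]
    simp [hT, add_assoc]
  have hφK : ∀ Q : K, ∃ s : F, φ Q.1.rep = s • (π Q).1.rep := by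
    intro Q
    obtain ⟨s, hs⟩ := hTline 0 1 Q
    rw [hT0, zero_add, zero_add, one_smul] at hs
    refine ⟨s, ?_⟩
    have h1 := hφH (arcVec hK.subset Q)
    rw [hs] at h1
    exact h1
  have hgK : ∀ P ∈ K, g P ∈ K := by
    intro P hP
    obtain ⟨s, hs⟩ := hφK ⟨P, hP⟩
    generalize π ⟨P, hP⟩ = Q at hs
    have h1 : g P = Q.1 := by
      rw [← P.mk_rep, hg, ← Q.1.mk_rep, Projectivization.mk_eq_mk_iff']
      exact ⟨s, hs.symm⟩
    rw [h1]
    exact Q.2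
  have hstab : (⟨g, hgΓ⟩ : PGammaL F V) ∈ MulAction.stabilizer (PGammaL F V) K := by
    rw [MulAction.mem_stabilizer_iff]
    -- The image of `K` lies in `K` and has the same finite cardinality, so it is all of `K`.
    refine Set.eq_of_subset_of_ncard_le ?_ ?_ (Set.toFinite _)
    · rintro _ ⟨P, hP, rfl⟩
      exact hgK P hP
    · exact (Set.ncard_image_of_injective K g.injective).ge
  refine ⟨⟨g, hgΓ⟩, hstab, fun P => ?_, fun L => ?_⟩
  · obtain ⟨u, hu⟩ := Θ.surjective (.inl P)
    obtain ⟨x, rfl⟩ : ∃ x, u = .inl x := by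
      rcases u with x | M
      · exact ⟨x, rfl⟩
      · obtain ⟨y, hy⟩ := exists_eq_lineThrough M
        obtain ⟨L, hL, -⟩ := hΘl M.1 y
        rw [← hy, hu] at hL
        cases hL
    obtain ⟨P', hP', hne, hPv⟩ := hΘp x
    obtain rfl : P' = P := Sum.inl.inj (hP'.symm.trans hu)
    obtain ⟨R, hR, hne', hRv⟩ := hΘp (f x)
    refine ⟨R, by rw [← hu, hαp, hR], ?_⟩
    change R.1 = g P'.1
    rw [hRv, hPv, hg]
    simp only [hφp]
  · obtain ⟨u, hu⟩ := Θ.surjective (.inr L)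
    obtain ⟨M, rfl⟩ : ∃ M, u = .inr M := by
      rcases u with x | M
      · obtain ⟨P, hP, -⟩ := hΘp x
        rw [hu] at hP
        cases hP
      · exact ⟨M, rfl⟩
    obtain ⟨x, hx⟩ := exists_eq_lineThrough M
    obtain ⟨L', hL', hLv⟩ := hΘl M.1 x
    rw [← hx] at hL'
    obtain rfl : L' = L := Sum.inr.inj (hL'.symm.trans hu)
    obtain ⟨R, hR, hRv⟩ := hΘl (π M.1) (f x)
    refine ⟨R, by rw [← hu, hx, hαl, hR], ?_⟩
    change pointsOf R.1 = g '' pointsOf L'.1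
    rw [← pointsOf_semilinearImage (hφ := hφ) hg]
    congr 1
    have : FiniteDimensional F R.1 := FiniteDimensional.of_finrank_pos (by rw [R.2.1]; norm_num)
    refine (Submodule.eq_of_le_of_finrank_eq ?_
      ((finrank_semilinearImage.trans L'.2.1).trans R.2.1.symm)).symm
    rintro _ ⟨v, hv, rfl⟩
    obtain ⟨t, ht⟩ := (hLv v).1 hv
    obtain ⟨s, hs⟩ := hφK M.1
    rw [ht, map_add, hφ, hφp, hφ, hs]
    refine R.1.add_mem (R.1.smul_mem _ ((hRv _).2 ⟨0, ?_⟩))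
      (R.1.smul_mem _ (R.1.smul_mem _ ((hRv _).2 ⟨1, ?_⟩)))
    · rw [map_add, he, hH0, add_zero, one_smul, zero_smul, add_zero]
    · have h1 : ℓ (π M.1).1.rep = 0 := hH0 (arcVec hK.subset (π M.1))
      rw [h1, zero_smul, zero_add, one_smul]

end InducedAutomorphisms

/-! ### The group isomorphism -/

theorem mainTheorem1 {F V : Type*} [Field F] [Finite F] [AddCommGroup V] [Module F V]
    (n q : ℕ) (hq : Nat.card F = q)
    (hnq : ((n + 3 ≤ q ∨ (q = n + 2 ∧ q.Prime)) ∧ 3 ≤ n) ∨ (n = 2 ∧ Odd q))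
    (hV : Module.finrank F V = n + 2)
    (H : Submodule F V) (hH : Module.finrank F H = n + 1)
    (K : Set (ℙ F V)) (hK : IsArc H q K) :
    ∃ e : MulAction.stabilizer (PGammaL F V) K ≃* (linRepGraph H K ≃g linRepGraph H K),
      ∀ g : MulAction.stabilizer (PGammaL F V) K,
        IsInducedBy (e g) ((g : PGammaL F V) : Equiv.Perm (ℙ F V)) := by
  have : FiniteDimensional F V := FiniteDimensional.of_finrank_pos (by omega)
  have : Finite V := Module.finite_of_finite F
  have hKfin : Finite K := inferInstance
  have hd := hK.isArcFamily
  have hspan := hd.span_range_eq_top (by omega) rfl (by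
    rw [Nat.card_coe_set_eq, Set.ncard, hK.encard_eq]
    exact hK.le_card)
  have hHtop : H ≠ ⊤ := by
    rintro rfl
    rw [finrank_top] at hH
    omega
  have hex : ∀ g : MulAction.stabilizer (PGammaL F V) K, ∃ α : linRepGraph H K ≃g linRepGraph H K,
      IsInducedBy α ((g : PGammaL F V) : Equiv.Perm (ℙ F V)) := by
    intro g
    obtain ⟨σ, φ, hφ, hg⟩ := g.1.2
    have hgK := apply_mem_iff_of_mem_stabilizer g.2
    exact exists_isInducedBy hφ hg hgK (apply_mem_iff_of_span_eq_top hK.subset hspan hφ hg hgK)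
  choose e he using hex
  -- The induced automorphism is unique, so the pointwise choice `e` is automatically
  -- multiplicative.
  let E : MulAction.stabilizer (PGammaL F V) K →* (linRepGraph H K ≃g linRepGraph H K) :=
    MonoidHom.mk' e fun g g' => (he (g * g')).unique ((he g).mul (he g'))
  refine ⟨MulEquiv.ofBijective E ⟨fun g g' h => ?_, fun α => ?_⟩, he⟩
  · obtain ⟨σ, φ, hφ, hg⟩ := g.1.2
    obtain ⟨σ', φ', hφ', hg'⟩ := g'.1.2
    have hind' := he g'
    rw [← show e g = e g' from h] at hind'
    exact Subtype.ext (Subtype.ext (eq_of_isInducedBy hHtop hg hg'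
      (apply_mem_iff_of_span_eq_top hK.subset hspan hφ hg (apply_mem_iff_of_mem_stabilizer g.2))
      (apply_mem_iff_of_span_eq_top hK.subset hspan hφ' hg' (apply_mem_iff_of_mem_stabilizer g'.2))
      (he g) hind'))
  · obtain ⟨g, hgK, hg⟩ := exists_isInducedBy_of_iso hq hnq hV hH hK α
    exact ⟨⟨g, hgK⟩, (he ⟨g, hgK⟩).unique hg⟩
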